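/- Let $M$ be a smooth manifold of dimension $2n$ with a symplectic form $J_{ab}$, let $J^{ab}$ be the skew inverse with $J_{ab}J^{ac}=\delta_b{}^c$, and let $\nabla_a$ be a symplectic connection on $M$, i.e. a torsion-free connection on the tangent bundle with $\nabla_aJ_{bc}=0$. Let $R_{ab}{}^c{}_d$ be its curvature, $(\nabla_a\nabla_b-\nabla_b\nabla_a)X^c=R_{ab}{}^c{}_dX^d$. Put $$\Phi_{bd}=\tfrac1{2(n+1)}R_{ab}{}^a{}_d,\qquad S_a=\tfrac1{2n+1}J^{bc}\nabla_c\Phi_{ab},$$ and define $V_{ab}{}^c{}_d$ by $$R_{ab}{}^c{}_d=V_{ab}{}^c{}_d+\delta_a{}^c\Phi_{bd}-\delta_b{}^c\Phi_{ad}+J_{ad}\Phi_{be}J^{ce}-J_{bd}\Phi_{ae}J^{ce}+2J_{ab}\Phi_{de}J^{ce}.$$ Then $\Phi_{ab}$ is symmetric and $V_{ab}{}^a{}_d=0$. Moreover, the bundle $\mathcal T=\Lambda^0\oplus\Lambda^1\oplus\Lambda^0$ is a smooth vector bundle of rank $2n+2$, and $$\nabla_a\begin{bmatrix}\sigma\\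 \mu_b\\ \rho\end{bmatrix}=\begin{bmatrix}\nabla_a\sigma-\mu_a\\ \nabla_a\mu_b+J_{ab}\rho+\Phi_{ab}\sigma\\ \nabla_a\rho-\Phi_{ab}J^{bc}\mu_c+S_a\sigma\end{bmatrix}$$ defines a smooth connection on $\mathcal T$ (the tractor connection). The pair is natural: if $f:M\to M'$ is a local diffeomorphism between two such manifolds that preserves the symplectic forms and the symplectic connections, then pulling back sections of $\mathcal T$ by $f$ intertwines the two tractor connections. Call a connection on a vector bundle $E$ over $M$ symplectically flat if there is a smooth bundle endomorphism $\Theta:E\to E$ such that $(\nabla_a\nabla_b-\nabla_b\nabla_a)\Sigma=2J_{ab}\Theta\Sigma$ for all smooth sections $\Sigma$ of $E$. Then the following are equivalent: 1. the tractor connection is symplectically flat; 2. there is a smooth symmetric tensor $\Psi_{ab}$ on $M$ with $$R_{ab}{}^c{}_d=\delta_a{}^c\Psi_{bd}-\delta_b{}^c\Psi_{ad}+J_{ad}\Psi_{be}J^{ce}-J_{bd}\Psi_{ae}J^{ce}+2J_{ab}\Psi_{de}J^{ce};$$ 3. $V_{ab}{}^c{}_d=0$. -/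

import Mathlib

open Bundle Manifold
open scoped Manifold ContDiff

universe u

namespace SymplecticTractor

/-- The model space `ℝ²ⁿ`. -/
abbrev Model (n : ℕ) : Type := EuclideanSpace ℝ (Fin (2 * n))

noncomputable section

section Sections

variable (n : ℕ) {M : Type u} [TopologicalSpace M] [ChartedSpace (Model n) M]
  (F : Type*) [NormedAddCommGroup F] [NormedSpace ℝ F]
  {V : M → Type*} [TopologicalSpace (TotalSpace F V)]
  [∀ x, AddCommGroup (V x)] [∀ x, Module ℝ (V x)] [∀ x, TopologicalSpace (V x)]
  [∀ x, IsTopologicalAddGroup (V x)] [∀ x, ContinuousSMul ℝ (V x)]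
  [FiberBundle F V]

/-- Smooth sections of a vector bundle with model fibre `F`. -/
def IsSmoothSection (s : Π x : M, V x) : Prop :=
  ContMDiff (𝓡 (2 * n)) ((𝓡 (2 * n)).prod 𝓘(ℝ, F)) ∞ (fun x ↦ TotalSpace.mk' F x (s x))

variable {n F}

/-- The curvature `∇_X ∇_Y s - ∇_Y ∇_X s - ∇_[X, Y] s` of a connection on a vector bundle. -/
def curvature (D : CovariantDerivative (𝓡 (2 * n)) F V)
    (X Y : Π x : M, TangentSpace (𝓡 (2 * n)) x) (s : Π x : M, V x) (x : M) : V x :=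
  D (fun y ↦ D s y (Y y)) x (X x) - D (fun y ↦ D s y (X y)) x (Y x)
    - D s x (VectorField.mlieBracket (𝓡 (2 * n)) X Y x)

end Sections

variable (n : ℕ) (M : Type u) [TopologicalSpace M] [ChartedSpace (Model n) M]
  [IsManifold (𝓡 (2 * n)) ∞ M]

/-- A symplectic form `J_ab` on a `2n`-dimensional manifold: a smooth, skew, non-degenerate, closed
two-form. -/
structure SymplecticForm where
  /-- the bilinear form on each tangent space -/
  form (x : M) : TangentSpace (𝓡 (2 * n)) x →L[ℝ] TangentSpace (𝓡 (2 * n)) x →L[ℝ] ℝ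
  smooth : ContMDiff (𝓡 (2 * n)) ((𝓡 (2 * n)).prod 𝓘(ℝ, Model n →L[ℝ] Model n →L[ℝ] ℝ)) ∞
    (fun x ↦ TotalSpace.mk' (Model n →L[ℝ] Model n →L[ℝ] ℝ) x (form x))
  skew (x : M) (u v : TangentSpace (𝓡 (2 * n)) x) : form x u v = - form x v u
  nondegenerate (x : M) (u : TangentSpace (𝓡 (2 * n)) x) (hu : ∀ v, form x u v = 0) : u = 0
  closed (X Y Z : Π x : M, TangentSpace (𝓡 (2 * n)) x)
    (hX : IsSmoothSection n (Model n) X) (hY : IsSmoothSection n (Model n) Y)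
    (hZ : IsSmoothSection n (Model n) Z) (x : M) :
    mvfderiv (𝓡 (2 * n)) (fun y ↦ form y (Y y) (Z y)) x (X x)
      + mvfderiv (𝓡 (2 * n)) (fun y ↦ form y (Z y) (X y)) x (Y x)
      + mvfderiv (𝓡 (2 * n)) (fun y ↦ form y (X y) (Y y)) x (Z x)
      - form x (VectorField.mlieBracket (𝓡 (2 * n)) X Y x) (Z x)
      - form x (VectorField.mlieBracket (𝓡 (2 * n)) Y Z x) (X x)
      - form x (VectorField.mlieBracket (𝓡 (2 * n)) Z X x) (Y x) = 0

/-- Connections on the tangent bundle. -/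
abbrev AffineConnection : Type u :=
  CovariantDerivative (𝓡 (2 * n)) (Model n) (TangentSpace (𝓡 (2 * n)) : M → Type)

/-- The fibres of `Λ⁰ ⊕ Λ¹ ⊕ Λ⁰`. -/
abbrev Tractor : M → Type :=
  (Bundle.Trivial M ℝ) ×ᵇ
    ((fun x : M ↦ TangentSpace (𝓡 (2 * n)) x →L[ℝ] Bundle.Trivial M ℝ x) ×ᵇ (Bundle.Trivial M ℝ))

/-- The model fibre of the tractor bundle. -/
abbrev TractorModel : Type := ℝ × (Model n →L[ℝ] ℝ) × ℝ

variable {n M}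

/-- A symplectic connection: a smooth torsion-free connection with `∇J = 0`. -/
structure IsSymplecticConnection (J : SymplecticForm n M) (cov : AffineConnection n M) : Prop where
  smooth : CovariantDerivative.ContMDiffCovariantDerivative cov ∞
  torsion_eq_zero : cov.torsion = 0
  parallel (X Y Z : Π x : M, TangentSpace (𝓡 (2 * n)) x)
    (hX : IsSmoothSection n (Model n) X) (hY : IsSmoothSection n (Model n) Y)
    (hZ : IsSmoothSection n (Model n) Z) (x : M) :
    mvfderiv (𝓡 (2 * n)) (fun y ↦ J.form y (Y y) (Z y)) x (X x)
      = J.form x (cov Y x (X x)) (Z x) + J.form x (Y x) (cov Z x (X x))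

instance (x : M) : FiniteDimensional ℝ (TangentSpace (𝓡 (2 * n)) x) :=
  inferInstanceAs (FiniteDimensional ℝ (Model n))

instance (x : M) : T2Space (TangentSpace (𝓡 (2 * n)) x) :=
  inferInstanceAs (T2Space (Model n))

/-- The inverse `μ_b ↦ J^{ab} μ_b` of the isomorphism `X^a ↦ X^a J_ab`; here `J_ab J^ac = δ_b^c`. -/
def SymplecticForm.sharp (J : SymplecticForm n M) (x : M) :
    (TangentSpace (𝓡 (2 * n)) x →L[ℝ] ℝ) →L[ℝ] TangentSpace (𝓡 (2 * n)) x :=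
  (J.form x).inverse

/-- `sharp` is the inverse of `X^a ↦ X^a J_ab`. -/
theorem SymplecticForm.form_sharp (J : SymplecticForm n M) (x : M)
    (μ : TangentSpace (𝓡 (2 * n)) x →L[ℝ] ℝ) : J.form x (J.sharp x μ) = μ := by
  have hinj : Function.Injective (J.form x).toLinearMap := by
    rw [← LinearMap.ker_eq_bot, LinearMap.ker_eq_bot']
    intro u hu
    exact J.nondegenerate x u fun v ↦ by
      have h2 : J.form x u = 0 := hu
      rw [h2]; rfl
  have hfin : Module.finrank ℝ (TangentSpace (𝓡 (2 * n)) x)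
      = Module.finrank ℝ (TangentSpace (𝓡 (2 * n)) x →L[ℝ] ℝ) :=
    (Subspace.dual_finrank_eq (K := ℝ) (V := TangentSpace (𝓡 (2 * n)) x)).symm.trans
      (LinearMap.toContinuousLinearMap (𝕜 := ℝ)
        (E := TangentSpace (𝓡 (2 * n)) x) (F' := ℝ)).finrank_eq
  have : FiniteDimensional ℝ (TangentSpace (𝓡 (2 * n)) x →L[ℝ] ℝ) :=
    inferInstanceAs (FiniteDimensional ℝ (Model n →L[ℝ] ℝ))
  have hinv : (J.form x).IsInvertible :=
    ⟨(LinearEquiv.ofInjectiveOfFinrankEq _ hinj hfin).toContinuousLinearEquiv, by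
      ext u v; rfl⟩
  exact hinv.self_apply_inverse μ

/-- The coordinate basis of the tangent space at `x`. -/
def coordBasis (x : M) : Module.Basis (Fin (2 * n)) ℝ (TangentSpace (𝓡 (2 * n)) x) :=
  (EuclideanSpace.basisFun (Fin (2 * n)) ℝ).toBasis

/-- The coordinate vector fields of the preferred chart at `x`, smooth on the domain of the
chart. -/
def coordField (x : M) (i : Fin (2 * n)) : Π y : M, TangentSpace (𝓡 (2 * n)) y :=
  FiberBundle.extend (Model n) (coordBasis x i)

/-- The curvature tensor, `curvatureTensor cov x X Y Z = R_ab^c_d X^a Y^b Z^d`, where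
`(∇_a ∇_b - ∇_b ∇_a) Z^c = R_ab^c_d Z^d`. It is the trilinear map given on the coordinate basis
by the curvature of the coordinate vector fields. -/
def curvatureTensor (cov : AffineConnection n M) (x : M) :
    TangentSpace (𝓡 (2 * n)) x →ₗ[ℝ] TangentSpace (𝓡 (2 * n)) x →ₗ[ℝ]
      TangentSpace (𝓡 (2 * n)) x →ₗ[ℝ] TangentSpace (𝓡 (2 * n)) x :=
  (coordBasis x).constr ℝ fun i ↦ (coordBasis x).constr ℝ fun j ↦ (coordBasis x).constr ℝ fun k ↦
    curvature cov (coordField x i) (coordField x j) (coordField x k) x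

/-- The Ricci tensor `R_ab^a_d`. -/
def ricci (cov : AffineConnection n M) (x : M) :
    TangentSpace (𝓡 (2 * n)) x →ₗ[ℝ] TangentSpace (𝓡 (2 * n)) x →ₗ[ℝ] ℝ :=
  ∑ i, (curvatureTensor cov x (coordBasis x i)).compr₂ ((coordBasis x).coord i)

/-- The tensor `Φ_bd = (1 / (2(n+1))) R_ab^a_d`. -/
def phi (cov : AffineConnection n M) (x : M) :
    TangentSpace (𝓡 (2 * n)) x →L[ℝ] TangentSpace (𝓡 (2 * n)) x →L[ℝ] ℝ :=
  ((1 / (2 * ((n : ℝ) + 1))) • ricci cov x).toContinuousBilinearMap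

/-- The curvature expression
`δ_a^c Φ_bd - δ_b^c Φ_ad + J_ad Φ_be J^ce - J_bd Φ_ae J^ce + 2 J_ab Φ_de J^ce`
contracted with `u^a v^b w^d`. -/
def phiCurvature (J : SymplecticForm n M)
    (Φ : Π x : M, TangentSpace (𝓡 (2 * n)) x →L[ℝ] TangentSpace (𝓡 (2 * n)) x →L[ℝ] ℝ)
    (x : M) (u v w : TangentSpace (𝓡 (2 * n)) x) : TangentSpace (𝓡 (2 * n)) x :=
  Φ x v w • u - Φ x u w • v + J.form x u w • J.sharp x (Φ x v) - J.form x v w • J.sharp x (Φ x u)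
    + (2 * J.form x u v) • J.sharp x (Φ x w)

/-- The tensor `V_ab^c_d`, contracted with `u^a v^b w^d`: the part of the curvature
complementary to the one built from `Φ_ab`. -/
def vTensor (J : SymplecticForm n M) (cov : AffineConnection n M) (x : M)
    (u v w : TangentSpace (𝓡 (2 * n)) x) : TangentSpace (𝓡 (2 * n)) x :=
  curvatureTensor cov x u v w - phiCurvature J (phi cov) x u v w

/-- The curvature has the form
`R_ab^c_d = δ_a^c Φ_bd - δ_b^c Φ_ad + J_ad Φ_be J^ce - J_bd Φ_ae J^ce + 2 J_ab Φ_de J^ce`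
for some smooth symmetric tensor `Φ_ab`. -/
def HasPhiCurvature (J : SymplecticForm n M) (cov : AffineConnection n M) : Prop :=
  ∃ Φ : Π x : M, TangentSpace (𝓡 (2 * n)) x →L[ℝ] TangentSpace (𝓡 (2 * n)) x →L[ℝ] ℝ,
    ContMDiff (𝓡 (2 * n)) ((𝓡 (2 * n)).prod 𝓘(ℝ, Model n →L[ℝ] Model n →L[ℝ] ℝ)) ∞
      (fun x ↦ TotalSpace.mk' (Model n →L[ℝ] Model n →L[ℝ] ℝ) x (Φ x)) ∧
    (∀ x u v, Φ x u v = Φ x v u) ∧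
    ∀ x u v w, curvatureTensor cov x u v w = phiCurvature J Φ x u v w

/-- The covariant derivative of a bilinear form:
`covDerivForm cov Φ x u v w = (∇_w Φ)(u, v) = u^a v^b w^c ∇_c Φ_ab`. -/
def covDerivForm (cov : AffineConnection n M)
    (Φ : Π x : M, TangentSpace (𝓡 (2 * n)) x →L[ℝ] TangentSpace (𝓡 (2 * n)) x →L[ℝ] ℝ) (x : M) :
    TangentSpace (𝓡 (2 * n)) x →ₗ[ℝ] TangentSpace (𝓡 (2 * n)) x →ₗ[ℝ]
      TangentSpace (𝓡 (2 * n)) x →ₗ[ℝ] ℝ :=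
  (coordBasis x).constr ℝ fun i ↦ (coordBasis x).constr ℝ fun j ↦
    { toFun := fun w ↦
        mvfderiv (𝓡 (2 * n)) (fun y ↦ Φ y (coordField x i y) (coordField x j y)) x w
          - Φ x (cov (coordField x i) x w) (coordBasis x j)
          - Φ x (coordBasis x i) (cov (coordField x j) x w)
      map_add' := fun w w' ↦ by simp only [map_add, add_apply]; ring
      map_smul' := fun c w ↦ by simp [mul_sub] }

/-- The covariant derivative of a one-form: `covDerivCovector cov μ x w v = w^a v^b ∇_a μ_b`. -/
def covDerivCovector (cov : AffineConnection n M)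
    (μ : Π x : M, TangentSpace (𝓡 (2 * n)) x →L[ℝ] ℝ) (x : M) :
    TangentSpace (𝓡 (2 * n)) x →L[ℝ] TangentSpace (𝓡 (2 * n)) x →L[ℝ] ℝ :=
  LinearMap.toContinuousBilinearMap <| LinearMap.flip <| (coordBasis x).constr ℝ fun j ↦
    { toFun := fun w ↦
        mvfderiv (𝓡 (2 * n)) (fun y ↦ μ y (coordField x j y)) x w - μ x (cov (coordField x j) x w)
      map_add' := fun w w' ↦ by simp only [map_add]; ring
      map_smul' := fun c w ↦ by simp [mul_sub] }

/-- The one-form `S_a = (1 / (2n+1)) J^bc ∇_c Φ_ab`; a contraction `J^bc B_bc` is computed as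
`∑_j B(J^♯ θ^j, e_j)` with `e_j` a basis and `θ^j` its dual basis. -/
def sForm (J : SymplecticForm n M) (cov : AffineConnection n M) (x : M) :
    TangentSpace (𝓡 (2 * n)) x →L[ℝ] ℝ :=
  LinearMap.toContinuousLinearMap <| (coordBasis x).constr ℝ fun i ↦
    (1 / (2 * (n : ℝ) + 1)) * ∑ j, covDerivForm cov (phi cov) x (coordBasis x i)
      (J.sharp x (LinearMap.toContinuousLinearMap ((coordBasis x).coord j))) (coordBasis x j)

/-- The tractor connection on `Λ⁰ ⊕ Λ¹ ⊕ Λ⁰`: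
`∇_a (σ, μ_b, ρ) = (∇_a σ - μ_a, ∇_a μ_b + J_ab ρ + Φ_ab σ, ∇_a ρ - Φ_ab J^bc μ_c + S_a σ)`. -/
def tractorDerivative (J : SymplecticForm n M) (cov : AffineConnection n M)
    (s : Π x : M, Tractor n M x) (x : M) :
    TangentSpace (𝓡 (2 * n)) x →L[ℝ] Tractor n M x :=
  letI σ : M → ℝ := fun y ↦ (s y).1
  letI μ : Π y : M, TangentSpace (𝓡 (2 * n)) y →L[ℝ] ℝ := fun y ↦ (s y).2.1
  letI ρ : M → ℝ := fun y ↦ (s y).2.2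
  ContinuousLinearMap.prod (mvfderiv (𝓡 (2 * n)) σ x - μ x) <|
  ContinuousLinearMap.prod
    (covDerivCovector cov μ x + ρ x • J.form x + σ x • phi cov x)
    (mvfderiv (𝓡 (2 * n)) ρ x
      - LinearMap.toContinuousLinearMap
          { toFun := fun u ↦ phi cov x u (J.sharp x (μ x))
            map_add' := fun u v ↦ by simp
            map_smul' := fun c u ↦ by simp }
      + σ x • sForm J cov x)

/-- The tractor bundle over `M` is pulled back by a local diffeomorphism `f : M → M'` fibrewise:
`(σ, μ, ρ) ↦ (σ, μ ∘ df, ρ)`. -/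
def tractorPullback {M' : Type u} [TopologicalSpace M'] [ChartedSpace (Model n) M']
    [IsManifold (𝓡 (2 * n)) ∞ M'] (f : M → M') (x : M) (t : Tractor n M' (f x)) : Tractor n M x :=
  (t.1, ContinuousLinearMap.comp (t.2.1 : TangentSpace (𝓡 (2 * n)) (f x) →L[ℝ] ℝ)
    (mfderiv (𝓡 (2 * n)) (𝓡 (2 * n)) f x), t.2.2)

/-- A local diffeomorphism that preserves the symplectic forms and the connections. -/
structure IsLocalIsomorphism {M' : Type u} [TopologicalSpace M'] [ChartedSpace (Model n) M']
    [IsManifold (𝓡 (2 * n)) ∞ M'] (J : SymplecticForm n M) (cov : AffineConnection n M)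
    (J' : SymplecticForm n M') (cov' : AffineConnection n M') (f : M → M') : Prop where
  isLocalDiffeomorph : IsLocalDiffeomorph (𝓡 (2 * n)) (𝓡 (2 * n)) ∞ f
  form_eq (x : M) (u v : TangentSpace (𝓡 (2 * n)) x) :
    J'.form (f x) (mfderiv (𝓡 (2 * n)) (𝓡 (2 * n)) f x u)
      (mfderiv (𝓡 (2 * n)) (𝓡 (2 * n)) f x v) = J.form x u v
  connection_eq (Y : Π x : M, TangentSpace (𝓡 (2 * n)) x)
    (Y' : Π x : M', TangentSpace (𝓡 (2 * n)) x)
    (hY : IsSmoothSection n (Model n) Y) (hY' : IsSmoothSection n (Model n) Y')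
    (h : ∀ x, Y' (f x) = mfderiv (𝓡 (2 * n)) (𝓡 (2 * n)) f x (Y x))
    (x : M) (u : TangentSpace (𝓡 (2 * n)) x) :
    cov' Y' (f x) (mfderiv (𝓡 (2 * n)) (𝓡 (2 * n)) f x u)
      = mfderiv (𝓡 (2 * n)) (𝓡 (2 * n)) f x (cov Y x u)

/-- A connection on a vector bundle over a symplectic manifold is symplectically flat if
`(∇_a ∇_b - ∇_b ∇_a) s = 2 J_ab Θ s` for a smooth bundle endomorphism `Θ`. -/
def IsSymplecticallyFlat (J : SymplecticForm n M)
    {F : Type*} [NormedAddCommGroup F] [NormedSpace ℝ F]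
    {V : M → Type*} [TopologicalSpace (TotalSpace F V)]
    [∀ x, AddCommGroup (V x)] [∀ x, Module ℝ (V x)] [∀ x, TopologicalSpace (V x)]
    [∀ x, IsTopologicalAddGroup (V x)] [∀ x, ContinuousSMul ℝ (V x)]
    [FiberBundle F V] (D : CovariantDerivative (𝓡 (2 * n)) F V) : Prop :=
  ∃ Θ : Π x : M, V x →L[ℝ] V x,
    (∀ s : Π x : M, V x, IsSmoothSection n F s → IsSmoothSection n F (fun x ↦ Θ x (s x))) ∧
    ∀ (X Y : Π x : M, TangentSpace (𝓡 (2 * n)) x) (s : Π x : M, V x),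
      IsSmoothSection n (Model n) X → IsSmoothSection n (Model n) Y → IsSmoothSection n F s →
      ∀ x, curvature D X Y s x = (2 * J.form x (X x) (Y x)) • Θ x (s x)

end

end SymplecticTractor

open SymplecticTractor

/-!
# Symplectic flatness of the tractor connection

A torsion-free symplectic connection makes the smooth functions and vector fields on `M` into a
`SymplecticCalculus`. In it the Bianchi identities, the curvature of the tractor connection and the
consequences of `V = 0` are identities in a commutative ring, and they hold at the points of `M`
because every tensor occurring in the statement is computed by its values on smooth vector fields
(`curvatureTensor_apply`, `covDerivForm_apply`, `covDerivCovector_apply`). The first Bianchi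
identity and the invariance of `J` give the symmetry of `Φ` and, with `trace_phiCurvature`, the
vanishing of the trace of `V`. The tractor derivative satisfies the Leibniz rule by inspection. It
is natural since a smooth vector field on `M'` lifts through a local isomorphism, and all tensors
are obtained by operations which commute with the lift.

The three equivalent conditions are compared through `V = 0`. A curvature of the form in the second
condition has Ricci trace `2 (n + 1) Ψ`, so that `Ψ = Φ` (`hasPhiCurvature_iff`). On a section with
components `(0, μ, 0)` at a point, the one-form component of the tractor curvature is
`-V_ab^c_d μ_c - 2 J_ab J^ce Φ_de μ_c`. For a symplectically flat connection this forces
`V_ab^c_d = J_ab Z^c_d`, and since `V` is trace-free and `J` non-degenerate, `V = 0`.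

Conversely let `V = 0`. Inserting the form of the curvature into the second Bianchi identity and
contracting yields `∇_a Φ_bc - ∇_b Φ_ac = -J_ac S_b + J_bc S_a - 2 J_ab S_c`
(`covDerivForm_skew_part`). Skew-symmetrizing one more derivative of this equation and using the
Ricci identity shows that the skew part of `∇_a S_b - Φ_ac J^ce Φ_be` is a multiple of `J_ab`
(`derivSForm_skew_part`). These two facts turn the three components of the tractor curvature into
`2 J_ab` times the smooth endomorphism `flatEndomorphism`.
-/

namespace SymplecticTractor

open scoped Topology

noncomputable section

set_option linter.unusedSectionVars false

/-! ### Frames and smooth sections of vector bundles -/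

section Frames

variable {E : Type*} [NormedAddCommGroup E] [NormedSpace ℝ E] [FiniteDimensional ℝ E]
  {H : Type*} [TopologicalSpace H] {I : ModelWithCorners ℝ E H}
  {M : Type*} [TopologicalSpace M] [ChartedSpace H M] [IsManifold I ∞ M] [T2Space M]
  {F : Type*} [NormedAddCommGroup F] [NormedSpace ℝ F] [FiniteDimensional ℝ F]
  {V : M → Type*} [TopologicalSpace (TotalSpace F V)]
  [∀ x, AddCommGroup (V x)] [∀ x, Module ℝ (V x)] [∀ x, TopologicalSpace (V x)]
  [FiberBundle F V] [VectorBundle ℝ F V] [ContMDiffVectorBundle ∞ F V I]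

theorem exists_smooth_cutoff {x : M} {u : Set M} (hu : u ∈ 𝓝 x) :
    ∃ χ : M → ℝ, ContMDiff I 𝓘(ℝ) ∞ χ ∧ tsupport χ ⊆ u ∧ χ =ᶠ[𝓝 x] 1 := by
  obtain ⟨f, -, hf⟩ := (SmoothBumpFunction.nhds_basis_tsupport (I := I) x).mem_iff.1 hu
  exact ⟨f, f.contMDiff, hf, f.eventuallyEq_one⟩

variable (I F V) in
/-- Global smooth sections `e i` and smooth covector fields `θ i` of a vector bundle which near `x`
are the frame of the preferred trivialization at `x` induced by a basis of the model fibre, and its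
dual frame. -/
structure CutoffFrame {ι : Type*} (b : Module.Basis ι ℝ F) (x : M) where
  /-- the sections of the frame -/
  e : ι → Π y : M, V y
  /-- the dual covector fields -/
  θ : ι → Π y : M, V y →ₗ[ℝ] ℝ
  smooth_e (i : ι) : ContMDiff I (I.prod 𝓘(ℝ, F)) ∞ fun y ↦ TotalSpace.mk' F y (e i y)
  smooth_θ (i : ι) (s : Π y : M, V y)
    (hs : ContMDiff I (I.prod 𝓘(ℝ, F)) ∞ (fun y ↦ TotalSpace.mk' F y (s y))) :
    ContMDiff I 𝓘(ℝ) ∞ fun y ↦ θ i y (s y)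
  eventually_eq : ∀ᶠ y in 𝓝 x, ∀ i, e i y = (trivializationAt F V x).localFrame b i y
  eventually_basis : ∀ᶠ y in 𝓝 x,
    ∃ B : Module.Basis ι ℝ (V y), (∀ i, B i = e i y) ∧ ∀ i, B.coord i = θ i y

theorem nonempty_cutoffFrame {ι : Type*} [Fintype ι] (b : Module.Basis ι ℝ F) (x : M) :
    Nonempty (CutoffFrame I F V b x) := by
  set t := trivializationAt F V x with ht
  have hx : x ∈ t.baseSet := FiberBundle.mem_baseSet_trivializationAt F V x
  have hnhds : t.baseSet ∈ 𝓝 x := t.open_baseSet.mem_nhds hx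
  obtain ⟨χ, hχ, hsupp, hone⟩ := exists_smooth_cutoff (I := I) hnhds
  refine ⟨fun i ↦ χ • t.localFrame b i, fun i y ↦ χ y • t.localFrameCoeff I b i y,
    fun i ↦ ?_, fun i s hs ↦ ?_, ?_, ?_⟩
  · exact hχ.contMDiffOn.smul_section_of_tsupport t.open_baseSet hsupp
      (t.contMDiffOn_localFrame_baseSet ∞ b i)
  · have h1 := contMDiffOn_baseSet_localFrameCoeff (e := t) (I := I) (k := ∞) b
      (s := s) hs.contMDiffOn i
    refine contMDiff_of_tsupport fun y hy ↦ ?_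
    have hy' : y ∈ t.baseSet := hsupp (tsupport_smul_subset_left χ
      (fun y ↦ t.localFrameCoeff I b i y (s y)) hy)
    exact (hχ y).smul (h1.contMDiffAt (t.open_baseSet.mem_nhds hy'))
  · filter_upwards [hone] with y hy i
    simp [hy, ht]
  · filter_upwards [hone, hnhds] with y hy hy'
    refine ⟨t.basisAt b hy', fun i ↦ ?_, fun i ↦ ?_⟩
    · simp [hy, hy']
    · ext v
      have := t.localFrameCoeff_apply_of_mem_baseSet (I := I) b hy'
        (FiberBundle.extend F v : Π y, V y) i
      simp only [FiberBundle.extend_apply_self] at this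
      simp [hy, this]

theorem exists_smooth_section (x : M) (v : V x) :
    ∃ s : Π y : M, V y, ContMDiff I (I.prod 𝓘(ℝ, F)) ∞ (fun y ↦ TotalSpace.mk' F y (s y)) ∧
      s x = v := by
  obtain ⟨fr⟩ := nonempty_cutoffFrame (I := I) (V := V) (Module.finBasis ℝ F) x
  obtain ⟨B, hB, -⟩ := fr.eventually_basis.self_of_nhds
  refine ⟨fun y ↦ ∑ i, (B.repr v i) • fr.e i y, ?_, ?_⟩
  · exact ContMDiff.sum_section fun i _ ↦ (fr.smooth_e i).const_smul_section (a := B.repr v i)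
  · simp_rw [← hB]
    exact B.sum_repr v

/-- An operation on smooth sections which is linear over the smooth functions is computed at `x` by
the components of the section in a frame. -/
theorem CutoffFrame.tensorial_eq_sum {ι : Type*} [Fintype ι] {b : Module.Basis ι ℝ F} {x : M}
    (fr : CutoffFrame I F V b x) {A : Type*} [AddCommGroup A] [Module ℝ A]
    (Q : (Π y : M, V y) → A)
    (hadd : ∀ s t : Π y : M, V y,
      ContMDiff I (I.prod 𝓘(ℝ, F)) ∞ (fun y ↦ TotalSpace.mk' F y (s y)) →
      ContMDiff I (I.prod 𝓘(ℝ, F)) ∞ (fun y ↦ TotalSpace.mk' F y (t y)) → Q (s + t) = Q s + Q t)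
    (hsmul : ∀ (f : M → ℝ) (s : Π y : M, V y), ContMDiff I 𝓘(ℝ) ∞ f →
      ContMDiff I (I.prod 𝓘(ℝ, F)) ∞ (fun y ↦ TotalSpace.mk' F y (s y)) → Q (f • s) = f x • Q s)
    {s : Π y : M, V y} (hs : ContMDiff I (I.prod 𝓘(ℝ, F)) ∞ (fun y ↦ TotalSpace.mk' F y (s y))) :
    Q s = ∑ i, fr.θ i x (s x) • Q (fr.e i) := by
  classical
  have hsum : ∀ (u : Finset ι) (t : ι → Π y : M, V y),
      (∀ i, ContMDiff I (I.prod 𝓘(ℝ, F)) ∞ (fun y ↦ TotalSpace.mk' F y (t i y))) →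
      Q (∑ i ∈ u, t i) = ∑ i ∈ u, Q (t i) := by
    intro u t ht
    induction u using Finset.induction_on with
    | empty =>
      have h0 := hsmul (fun _ ↦ 0) s contMDiff_const hs
      have h1 : (fun _ : M ↦ (0 : ℝ)) • s = 0 := by ext y; simp
      simpa [h1] using h0
    | insert a u ha ih =>
      rw [Finset.sum_insert ha, Finset.sum_insert ha, ← ih]
      refine hadd _ _ (ht a) ?_
      convert! ContMDiff.sum_section (s := u) (fun i _ ↦ ht i) using 2
      simp
  have hθ (i : ι) := fr.smooth_θ i s hs
  have hterm (i : ι) : ContMDiff I (I.prod 𝓘(ℝ, F)) ∞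
      (fun y ↦ TotalSpace.mk' F y (((fun y ↦ fr.θ i y (s y)) • fr.e i) y)) :=
    (hθ i).smul_section (fr.smooth_e i)
  obtain ⟨χ, hχ, hsupp, hone⟩ := exists_smooth_cutoff (I := I) fr.eventually_basis
  have hχx : χ x = 1 := hone.self_of_nhds
  have key : χ • s = χ • ∑ i, (fun y ↦ fr.θ i y (s y)) • fr.e i := by
    ext y
    by_cases hy : χ y = 0
    · simp [hy]
    · obtain ⟨B, hB, hB'⟩ := hsupp (subset_tsupport χ hy)
      have := B.sum_repr (s y)
      simp only [Pi.smul_apply', Finset.sum_apply]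
      congr 1
      rw [← this]
      refine Finset.sum_congr rfl fun i _ ↦ ?_
      rw [← hB' i, hB i, this]; rfl
  calc Q s = Q (χ • s) := by rw [hsmul χ s hχ hs, hχx, one_smul]
    _ = Q (∑ i, (fun y ↦ fr.θ i y (s y)) • fr.e i) := by
      rw [key, hsmul χ _ hχ, hχx, one_smul]
      convert! ContMDiff.sum_section (s := Finset.univ) (fun i _ ↦ hterm i) using 2
      simp
    _ = _ := by
      rw [hsum _ _ hterm]
      exact Finset.sum_congr rfl fun i _ ↦ hsmul _ _ (hθ i) (fr.smooth_e i)

variable {F' : Type*} [NormedAddCommGroup F'] [NormedSpace ℝ F']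
  {W : M → Type*} [TopologicalSpace (TotalSpace F' W)]
  [∀ x, AddCommGroup (W x)] [∀ x, Module ℝ (W x)] [∀ x, TopologicalSpace (W x)]
  [∀ x, IsTopologicalAddGroup (W x)] [∀ x, ContinuousSMul ℝ (W x)]
  [FiberBundle F' W] [VectorBundle ℝ F' W] [ContMDiffVectorBundle ∞ F' W I]

/-- A homomorphism of vector bundles is smooth if it maps smooth sections to smooth sections. -/
theorem contMDiff_hom_of_apply (A : Π x : M, V x →L[ℝ] W x)
    (hA : ∀ s : Π y : M, V y, ContMDiff I (I.prod 𝓘(ℝ, F)) ∞ (fun y ↦ TotalSpace.mk' F y (s y)) →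
      ContMDiff I (I.prod 𝓘(ℝ, F')) ∞ (fun y ↦ TotalSpace.mk' F' y (A y (s y)))) :
    ContMDiff I (I.prod 𝓘(ℝ, F →L[ℝ] F')) ∞
      (fun x ↦ TotalSpace.mk' (F →L[ℝ] F') (E := fun x ↦ V x →L[ℝ] W x) x (A x)) := by
  intro x
  rw [contMDiffAt_hom_bundle]
  refine ⟨contMDiffAt_id, ?_⟩
  set b := Module.finBasis ℝ F
  obtain ⟨fr⟩ := nonempty_cutoffFrame (I := I) (V := V) b x
  have h1 (i) : ContMDiffAt I 𝓘(ℝ, F') ∞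
      (fun y ↦ (trivializationAt F' W x ⟨y, A y (fr.e i y)⟩).2) x :=
    (contMDiffAt_section _).1 (hA _ (fr.smooth_e i) x)
  have h2 : ContMDiffAt I 𝓘(ℝ, F →L[ℝ] F') ∞ (fun y ↦ ∑ i,
      (LinearMap.toContinuousLinearMap (b.coord i)).smulRight
        (trivializationAt F' W x ⟨y, A y (fr.e i y)⟩).2) x := by
    refine ContMDiffAt.sum fun i _ ↦ ?_
    exact ((ContinuousLinearMap.smulRightL ℝ F F'
      (LinearMap.toContinuousLinearMap (b.coord i))).contDiff.contMDiff.contMDiffAt).comp x (h1 i)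
  refine h2.congr_of_eventuallyEq ?_
  have hb1 := (trivializationAt F V x).open_baseSet.mem_nhds
    (FiberBundle.mem_baseSet_trivializationAt F V x)
  have hb2 := (trivializationAt F' W x).open_baseSet.mem_nhds
    (FiberBundle.mem_baseSet_trivializationAt F' W x)
  filter_upwards [fr.eventually_eq, hb1, hb2] with y hy hy1 hy2
  refine ContinuousLinearMap.coe_injective (b.ext fun i ↦ ?_)
  simp [hy, hy1, ContinuousLinearMap.inCoordinates, Trivialization.basisAt, hy2,
    Finsupp.single_apply]
end Frames

/-! ### Sections of the tractor bundle, covectors and brackets -/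

section Products

variable {E : Type*} [NormedAddCommGroup E] [NormedSpace ℝ E]
  {H : Type*} [TopologicalSpace H] {I : ModelWithCorners ℝ E H}
  {M : Type*} [TopologicalSpace M] [ChartedSpace H M]
  {F : Type*} [NormedAddCommGroup F] [NormedSpace ℝ F]
  {V : M → Type*} [TopologicalSpace (TotalSpace F V)]
  [∀ x, AddCommGroup (V x)] [∀ x, Module ℝ (V x)] [∀ x, TopologicalSpace (V x)]
  [FiberBundle F V] [VectorBundle ℝ F V]
  {F' : Type*} [NormedAddCommGroup F'] [NormedSpace ℝ F']
  {W : M → Type*} [TopologicalSpace (TotalSpace F' W)]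
  [∀ x, AddCommGroup (W x)] [∀ x, Module ℝ (W x)] [∀ x, TopologicalSpace (W x)]
  [FiberBundle F' W] [VectorBundle ℝ F' W]

theorem contMDiff_trivial_section_iff {f : M → F} :
    ContMDiff I (I.prod 𝓘(ℝ, F)) ∞ (fun x ↦ TotalSpace.mk' F (E := Bundle.Trivial M F) x (f x)) ↔
    ContMDiff I 𝓘(ℝ, F) ∞ f := by
  refine forall_congr' fun x ↦ ?_
  rw [contMDiffAt_section]
  simp

theorem mdifferentiableAt_trivial_section_iff {f : M → F} {x : M} :
    MDifferentiableAt I (I.prod 𝓘(ℝ, F))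
      (fun x ↦ TotalSpace.mk' F (E := Bundle.Trivial M F) x (f x)) x ↔
    MDifferentiableAt I 𝓘(ℝ, F) f x := by
  rw [mdifferentiableAt_section]
  simp

theorem contMDiff_prod_section_iff {s : Π x : M, V x × W x} :
    ContMDiff I (I.prod 𝓘(ℝ, F × F')) ∞
        (fun x ↦ TotalSpace.mk' (F × F') (E := V ×ᵇ W) x (s x)) ↔
      ContMDiff I (I.prod 𝓘(ℝ, F)) ∞ (fun x ↦ TotalSpace.mk' F x (s x).1) ∧
      ContMDiff I (I.prod 𝓘(ℝ, F')) ∞ (fun x ↦ TotalSpace.mk' F' x (s x).2) := by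
  simp only [ContMDiff, ← forall_and]
  refine forall_congr' fun x ↦ ?_
  rw [contMDiffAt_section, contMDiffAt_section, contMDiffAt_section]
  exact contMDiffAt_prod_module_iff _

theorem mdifferentiableAt_prod_section_iff {s : Π x : M, V x × W x} {x : M} :
    MDifferentiableAt I (I.prod 𝓘(ℝ, F × F'))
        (fun x ↦ TotalSpace.mk' (F × F') (E := V ×ᵇ W) x (s x)) x ↔
      MDifferentiableAt I (I.prod 𝓘(ℝ, F)) (fun x ↦ TotalSpace.mk' F x (s x).1) x ∧
      MDifferentiableAt I (I.prod 𝓘(ℝ, F')) (fun x ↦ TotalSpace.mk' F' x (s x).2) x := by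
  rw [mdifferentiableAt_section, mdifferentiableAt_section, mdifferentiableAt_section]
  exact mdifferentiableAt_prod_module_iff _

end Products

section TractorSections

variable {n : ℕ} {M : Type u} [TopologicalSpace M] [ChartedSpace (Model n) M]
  [IsManifold (𝓡 (2 * n)) ∞ M]

theorem finrank_tractor (x : M) : Module.finrank ℝ (Tractor n M x) = 2 * n + 2 := by
  have h : Module.finrank ℝ (Model n →L[ℝ] ℝ) = 2 * n := by
    rw [← (LinearMap.toContinuousLinearMap (𝕜 := ℝ) (E := Model n) (F' := ℝ)).finrank_eq,
      Subspace.dual_finrank_eq, finrank_euclideanSpace_fin]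
  change Module.finrank ℝ (ℝ × (Model n →L[ℝ] ℝ) × ℝ) = _
  rw [Module.finrank_prod, Module.finrank_prod, h, Module.finrank_self]
  omega

/-- A family of covectors is smooth if its values on smooth vector fields are smooth functions. -/
def IsSmoothCovector (μ : Π x : M, TangentSpace (𝓡 (2 * n)) x →L[ℝ] ℝ) : Prop :=
  ∀ Y : Π x : M, TangentSpace (𝓡 (2 * n)) x, IsSmoothSection n (Model n) Y →
    ContMDiff (𝓡 (2 * n)) 𝓘(ℝ) ∞ fun x ↦ μ x (Y x)

variable [T2Space M]
theorem contMDiff_covector_iff {μ : Π x : M, TangentSpace (𝓡 (2 * n)) x →L[ℝ] ℝ} :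
    ContMDiff (𝓡 (2 * n)) ((𝓡 (2 * n)).prod 𝓘(ℝ, Model n →L[ℝ] ℝ)) ∞
        (fun x ↦ TotalSpace.mk' (Model n →L[ℝ] ℝ)
          (E := fun x : M ↦ TangentSpace (𝓡 (2 * n)) x →L[ℝ] Bundle.Trivial M ℝ x) x (μ x)) ↔
      IsSmoothCovector μ := by
  refine ⟨fun h Y hY ↦ ?_, fun h ↦ contMDiff_hom_of_apply (W := Bundle.Trivial M ℝ) μ fun s hs ↦
    contMDiff_trivial_section_iff.2 (h s hs)⟩
  exact contMDiff_trivial_section_iff.1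
    (ContMDiff.clm_bundle_apply (F₂ := ℝ) (E₂ := Bundle.Trivial M ℝ) h hY)

theorem contMDiff_form_iff
    {B : Π x : M, TangentSpace (𝓡 (2 * n)) x →L[ℝ] TangentSpace (𝓡 (2 * n)) x →L[ℝ] ℝ} :
    ContMDiff (𝓡 (2 * n)) ((𝓡 (2 * n)).prod 𝓘(ℝ, Model n →L[ℝ] Model n →L[ℝ] ℝ)) ∞
        (fun x ↦ TotalSpace.mk' (Model n →L[ℝ] Model n →L[ℝ] ℝ) x (B x)) ↔
      ∀ Y, IsSmoothSection n (Model n) Y → IsSmoothCovector fun x ↦ B x (Y x) := by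
  refine ⟨fun h Y hY ↦ ?_, fun h ↦ contMDiff_hom_of_apply (F' := Model n →L[ℝ] ℝ)
    (W := fun x : M ↦ TangentSpace (𝓡 (2 * n)) x →L[ℝ] Bundle.Trivial M ℝ x) B fun s hs ↦
    contMDiff_covector_iff.2 (h s hs)⟩
  exact contMDiff_covector_iff.1 (ContMDiff.clm_bundle_apply (F₂ := Model n →L[ℝ] ℝ)
    (E₂ := fun x : M ↦ TangentSpace (𝓡 (2 * n)) x →L[ℝ] Bundle.Trivial M ℝ x) h hY)

theorem isSmoothSection_tractor_iff {s : Π x : M, Tractor n M x} :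
    IsSmoothSection n (TractorModel n) s ↔
      ContMDiff (𝓡 (2 * n)) 𝓘(ℝ, ℝ) ∞ (fun x ↦ (s x).1) ∧
      IsSmoothCovector (fun x ↦ (s x).2.1) ∧
      ContMDiff (𝓡 (2 * n)) 𝓘(ℝ, ℝ) ∞ (fun x ↦ (s x).2.2) := by
  rw [← contMDiff_trivial_section_iff, ← contMDiff_covector_iff]
  rw [← contMDiff_trivial_section_iff (f := fun x ↦ (s x).2.2)]
  exact contMDiff_prod_section_iff.trans (and_congr_right' contMDiff_prod_section_iff)

theorem isSmoothSection_mlieBracket {X Y : Π x : M, TangentSpace (𝓡 (2 * n)) x}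
    (hX : IsSmoothSection n (Model n) X) (hY : IsSmoothSection n (Model n) Y) :
    IsSmoothSection n (Model n) (VectorField.mlieBracket (𝓡 (2 * n)) X Y) :=
  haveI : IsManifold (𝓡 (2 * n)) (((⊤ : ℕ∞) : WithTop ℕ∞) + 1) M := ‹IsManifold (𝓡 (2 * n)) ∞ M›
  haveI : IsManifold (𝓡 (2 * n)) (minSmoothness ℝ 2) M := by
    simpa using (inferInstance : IsManifold (𝓡 (2 * n)) 2 M)
  ContDiff.mlieBracket_vectorField (m := ⊤) (n := ⊤) hX hY (by simp)

theorem contMDiff_mvfderiv_apply {X : Π x : M, TangentSpace (𝓡 (2 * n)) x} {f : M → ℝ}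
    (hX : IsSmoothSection n (Model n) X)
    (hf : ContMDiff (𝓡 (2 * n)) 𝓘(ℝ) ∞ f) :
    ContMDiff (𝓡 (2 * n)) 𝓘(ℝ) ∞ fun y ↦ mvfderiv (𝓡 (2 * n)) f y (X y) :=
  (contMDiff_snd_tangentBundle_modelSpace ℝ 𝓘(ℝ)).comp
    ((hf.contMDiff_tangentMap (m := ∞) (by simp)).comp hX)

/-- The Lie bracket acts on functions as the commutator of derivations. This is the Jacobi identity
for `X`, `Y` and `f • Z`, with `Z` a field that does not vanish at `x`. -/
theorem commutator_mvfderiv {X Y : Π x : M, TangentSpace (𝓡 (2 * n)) x} {f : M → ℝ}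
    (hX : IsSmoothSection n (Model n) X) (hY : IsSmoothSection n (Model n) Y)
    (hf : ContMDiff (𝓡 (2 * n)) 𝓘(ℝ) ∞ f) (x : M) :
    mvfderiv (𝓡 (2 * n)) (fun y ↦ mvfderiv (𝓡 (2 * n)) f y (Y y)) x (X x)
      - mvfderiv (𝓡 (2 * n)) (fun y ↦ mvfderiv (𝓡 (2 * n)) f y (X y)) x (Y x)
      = mvfderiv (𝓡 (2 * n)) f x (VectorField.mlieBracket (𝓡 (2 * n)) X Y x) := by
  by_cases hsub : Subsingleton (TangentSpace (𝓡 (2 * n)) x)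
  · simp [Subsingleton.elim (X x) 0, Subsingleton.elim (Y x) 0,
      Subsingleton.elim (VectorField.mlieBracket (𝓡 (2 * n)) X Y x) 0]
  rw [not_subsingleton_iff_nontrivial] at hsub
  obtain ⟨z, hz⟩ := exists_ne (0 : TangentSpace (𝓡 (2 * n)) x)
  obtain ⟨Z, hZ, rfl⟩ := exists_smooth_section (I := 𝓡 (2 * n)) (F := Model n) x z
  have key {U W : Π x : M, TangentSpace (𝓡 (2 * n)) x} {g : M → ℝ}
      (hW : IsSmoothSection n (Model n) W) (hg : ContMDiff (𝓡 (2 * n)) 𝓘(ℝ) ∞ g) :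
      VectorField.mlieBracket (𝓡 (2 * n)) U (g • W) =
        (fun y ↦ mvfderiv (𝓡 (2 * n)) g y (U y)) • W
          + g • VectorField.mlieBracket (𝓡 (2 * n)) U W := by
    ext1 y
    exact VectorField.mlieBracket_smul_right ((hg y).mdifferentiableAt (by simp))
      ((hW y).mdifferentiableAt (by simp))
  have hadd {U W W' : Π x : M, TangentSpace (𝓡 (2 * n)) x}
      (hW : IsSmoothSection n (Model n) W) (hW' : IsSmoothSection n (Model n) W') :
      VectorField.mlieBracket (𝓡 (2 * n)) U (W + W') =
        VectorField.mlieBracket (𝓡 (2 * n)) U W + VectorField.mlieBracket (𝓡 (2 * n)) U W' := by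
    ext1 y
    exact VectorField.mlieBracket_add_right ((hW y).mdifferentiableAt (by simp))
      ((hW' y).mdifferentiableAt (by simp))
  have hXf := contMDiff_mvfderiv_apply hX hf
  have hYf := contMDiff_mvfderiv_apply hY hf
  have hXZ := isSmoothSection_mlieBracket hX hZ
  have hYZ := isSmoothSection_mlieBracket hY hZ
  have le : minSmoothness ℝ 2 ≤ (∞ : WithTop ℕ∞) := by
    simpa using! (ENat.LEInfty.out : (2 : WithTop ℕ∞) ≤ ∞)
  have : IsManifold (𝓡 (2 * n)) (minSmoothness ℝ 3) M := by
    simpa using (inferInstance : IsManifold (𝓡 (2 * n)) 3 M)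
  have hjac := congr_fun (VectorField.leibniz_identity_mlieBracket (hX.of_le le) (hY.of_le le)
    ((hf.smul_section hZ).of_le le)) x
  have hjac' := congr_fun (VectorField.leibniz_identity_mlieBracket (hX.of_le le) (hY.of_le le)
    (hZ.of_le le)) x
  rw [key hZ hf, key hZ hf, key hZ hf, hadd (hYf.smul_section hZ) (hf.smul_section hYZ),
    hadd (hXf.smul_section hZ) (hf.smul_section hXZ), key hZ hYf, key hZ hXf, key hYZ hf,
    key hXZ hf] at hjac
  simp only [Pi.add_apply, Pi.smul_apply'] at hjac hjac'
  rw [hjac'] at hjac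
  refine smul_left_injective ℝ hz ?_
  simp only [sub_smul]
  rw [← sub_eq_zero] at hjac ⊢
  rw [← hjac]
  module

end TractorSections

/-! ### The algebra of a symplectic connection -/

/-- The algebra of a torsion-free symplectic connection: a ring `A` of functions, a group `L` of
vector fields differentiating them, a torsion-free connection on `L` and a parallel skew form. The
Jacobi identity of the bracket `∇_X Y - ∇_Y X` is stated as the first Bianchi identity. -/
structure SymplecticCalculus (A L : Type*) [CommRing A] [AddCommGroup L] where
  /-- the derivative of a function along a vector field -/
  d : L →+ A →+ A
  /-- the covariant derivative -/
  nab : L →+ L →+ L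
  /-- the symplectic form -/
  J : L →+ L →+ A
  d_mul (X : L) (f g : A) : d X (f * g) = d X f * g + f * d X g
  commutator (X Y : L) (f : A) : d X (d Y f) - d Y (d X f) = d (nab X Y - nab Y X) f
  jacobi (X Y Z : L) :
    (nab X (nab Y Z) - nab Y (nab X Z) - nab (nab X Y - nab Y X) Z) +
    (nab Y (nab Z X) - nab Z (nab Y X) - nab (nab Y Z - nab Z Y) X) +
    (nab Z (nab X Y) - nab X (nab Z Y) - nab (nab Z X - nab X Z) Y) = 0
  skew (X Y : L) : J X Y = - J Y X
  parallel (X Y Z : L) : d X (J Y Z) = J (nab X Y) Z + J Y (nab X Z)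

namespace SymplecticCalculus

variable {A L : Type*} [CommRing A] [AddCommGroup L] (C : SymplecticCalculus A L)

/-- The curvature `∇_X ∇_Y Z - ∇_Y ∇_X Z - ∇_[X, Y] Z`. -/
def curv (X Y Z : L) : L :=
  C.nab X (C.nab Y Z) - C.nab Y (C.nab X Z) - C.nab (C.nab X Y - C.nab Y X) Z

/-- The derivative `(∇_X Φ)(Y, Z)` of a bilinear form. -/
def DForm (Φ : L →+ L →+ A) (X Y Z : L) : A :=
  C.d X (Φ Y Z) - Φ (C.nab X Y) Z - Φ Y (C.nab X Z)

/-- The derivative `(∇_X S)(Y)` of a one-form. -/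
def DCov (S : L →+ A) (X Y : L) : A := C.d X (S Y) - S (C.nab X Y)

/-- `P_Φ(X, Y, Z, T) = R_abcd X^a Y^b Z^d T^c`, the curvature built from a bilinear form `Φ`
with its vector index lowered. -/
def phiCurv (Φ : L → L → A) (X Y Z T : L) : A :=
  Φ Y Z * C.J X T - Φ X Z * C.J Y T + C.J X Z * Φ Y T - C.J Y Z * Φ X T + 2 * C.J X Y * Φ Z T

theorem first_bianchi (X Y Z : L) : C.curv X Y Z + C.curv Y Z X + C.curv Z X Y = 0 :=
  C.jacobi X Y Z

/-- The curvature takes values in the symplectic Lie algebra, since `J` is parallel. -/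
theorem curv_symplectic (X Y Z W : L) : C.J (C.curv X Y Z) W = C.J (C.curv X Y W) Z := by
  have h := C.commutator X Y (C.J Z W)
  simp only [C.parallel, map_add] at h
  rw [C.skew (C.curv X Y W)]
  simp only [curv, map_sub, AddMonoidHom.sub_apply] at h ⊢
  linear_combination h

theorem second_bianchi (X Y Z W T : L) :
    C.J (C.nab X (C.curv Y Z W) - C.curv (C.nab X Y) Z W - C.curv Y (C.nab X Z) W
        - C.curv Y Z (C.nab X W)
      + (C.nab Y (C.curv Z X W) - C.curv (C.nab Y Z) X W - C.curv Z (C.nab Y X) W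
        - C.curv Z X (C.nab Y W))
      + (C.nab Z (C.curv X Y W) - C.curv (C.nab Z X) Y W - C.curv X (C.nab Z Y) W
        - C.curv X Y (C.nab Z W))) T = 0 := by
  have h := congr(C.J (C.nab $(C.jacobi X Y Z) W) T)
  simp only [curv, map_sub, map_add, map_zero, AddMonoidHom.sub_apply, AddMonoidHom.add_apply,
    AddMonoidHom.zero_apply] at h ⊢
  linear_combination -h

variable {Φ : L →+ L →+ A}

/-- The second Bianchi identity for a curvature built from `Φ`, in terms of `∇Φ`. -/
theorem second_bianchi_phiCurv
    (hR : ∀ X Y Z T, C.J (C.curv X Y Z) T = C.phiCurv (Φ · ·) X Y Z T) (X Y Z W T : L) :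
    C.phiCurv (C.DForm Φ X) Y Z W T + C.phiCurv (C.DForm Φ Y) Z X W T
      + C.phiCurv (C.DForm Φ Z) X Y W T = 0 := by
  have key (X Y Z : L) : C.phiCurv (C.DForm Φ X) Y Z W T =
      C.J (C.nab X (C.curv Y Z W) - C.curv (C.nab X Y) Z W - C.curv Y (C.nab X Z) W
        - C.curv Y Z (C.nab X W)) T := by
    have h := C.parallel X (C.curv Y Z W) T
    simp only [map_sub, AddMonoidHom.sub_apply, hR] at h ⊢
    have h' : C.J (C.nab X (C.curv Y Z W)) T = C.d X (C.phiCurv (Φ · ·) Y Z W T) -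
        C.phiCurv (Φ · ·) Y Z W (C.nab X T) := by linear_combination -h
    have h2 : C.d X 2 = 0 := by
      have h1 : C.d X 1 = 0 := by have := C.d_mul X 1 1; simp at this; exact this
      rw [← one_add_one_eq_two, map_add, h1, add_zero]
    rw [h']
    simp only [phiCurv, DForm, map_add, map_sub, C.d_mul, C.parallel, h2]
    ring
  rw [key X Y Z, key Y Z X, key Z X Y, ← AddMonoidHom.add_apply, ← AddMonoidHom.add_apply,
    ← map_add, ← map_add]
  exact C.second_bianchi X Y Z W T

/-- The derivative of the skew part `B_abc = ∇_a Φ_bc - ∇_b Φ_ac`, skew-symmetrized in three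
indices, involves only the curvature: the Ricci identity for `Φ`. -/
theorem cyclic_deriv_skew_part (E X Y Z : L) (B : L → L → L → A)
    (hB : ∀ X Y Z, B X Y Z = C.DForm Φ X Y Z - C.DForm Φ Y X Z) :
    (C.d E (B X Y Z) - B (C.nab E X) Y Z - B X (C.nab E Y) Z - B X Y (C.nab E Z)) +
    (C.d X (B Y E Z) - B (C.nab X Y) E Z - B Y (C.nab X E) Z - B Y E (C.nab X Z)) +
    (C.d Y (B E X Z) - B (C.nab Y E) X Z - B E (C.nab Y X) Z - B E X (C.nab Y Z)) +
    (Φ Y (C.curv E X Z) + Φ E (C.curv X Y Z) + Φ X (C.curv Y E Z)) = 0 := by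
  have h := congr(Φ $(C.jacobi E X Y) Z)
  have h1 := C.commutator E X (Φ Y Z)
  have h2 := C.commutator X Y (Φ E Z)
  have h3 := C.commutator Y E (Φ X Z)
  simp only [hB, DForm, curv, map_sub, map_add, map_zero, AddMonoidHom.sub_apply,
    AddMonoidHom.add_apply, AddMonoidHom.zero_apply] at h h1 h2 h3 ⊢
  linear_combination h1 + h2 + h3 - h

/-- If the curvature is built from a symmetric `Φ` and the skew part of `∇Φ` is built from `J` and
`S`, the Ricci identity for `Φ` becomes a linear relation between `J` and `N = ∇S - Φ J Φ`. -/
theorem cyclic_form_skew_part {S : L →+ A} {sh : L → L}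
    (hR : ∀ X Y Z T, C.J (C.curv X Y Z) T = C.phiCurv (Φ · ·) X Y Z T)
    (hsym : ∀ X Y, Φ X Y = Φ Y X) (hsh : ∀ X Y, C.J (sh X) Y = Φ X Y)
    (hB : ∀ X Y Z, C.DForm Φ X Y Z - C.DForm Φ Y X Z =
      - C.J X Z * S Y + C.J Y Z * S X - 2 * C.J X Y * S Z)
    (N : L → L → A) (hN : ∀ X Y, N X Y = C.DCov S X Y - Φ X (sh Y)) (E X Y Z : L) :
    C.J E Z * (N X Y - N Y X) + C.J X Z * (N Y E - N E Y) + C.J Y Z * (N E X - N X E) =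
      2 * (C.J E X * N Y Z + C.J X Y * N E Z + C.J Y E * N X Z) := by
  have h2 (X) : C.d X 2 = 0 := by
    have h1 : C.d X 1 = 0 := by have := C.d_mul X 1 1; simp at this; exact this
    rw [← one_add_one_eq_two, map_add, h1, add_zero]
  have key := C.cyclic_deriv_skew_part E X Y Z
    (fun X Y Z ↦ - C.J X Z * S Y + C.J Y Z * S X - 2 * C.J X Y * S Z) (fun X Y Z ↦ (hB X Y Z).symm)
  have hΦ (E X Y Z : L) : Φ Y (C.curv E X Z) = - C.phiCurv (Φ · ·) E X Z (sh Y) := by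
    rw [← hR, ← hsh, C.skew]
  have hs (X Y) : Φ X (sh Y) = - Φ Y (sh X) := by rw [← hsh, C.skew, hsh]
  have hJ (X Y) : C.J X (sh Y) = - Φ Y X := by rw [C.skew, hsh]
  simp only [hΦ, phiCurv, hJ, map_add, map_sub, map_neg, C.d_mul, C.parallel, h2] at key
  simp only [hN, DCov]
  rw [hs Y X, hs E Y, hs X E, hs Y Z, hs E Z, hs X Z]
  rw [hs Y X, hs E Y, hs X E, hsym Y X, hsym E Y, hsym X E] at key
  linear_combination key

/-- The first component of the tractor derivative of `(σ, μ, ρ)` along `X`. -/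
def top (X : L) (σ : A) (μ : L → A) : A := C.d X σ - μ X

/-- The one-form component, at `Y`, of the tractor derivative of `(σ, μ, ρ)` along `X`. -/
def mid (Φ : L →+ L →+ A) (X : L) (σ : A) (μ : L → A) (ρ : A) (Y : L) : A :=
  C.d X (μ Y) - μ (C.nab X Y) + ρ * C.J X Y + σ * Φ X Y

/-- The last component of the tractor derivative of `(σ, μ, ρ)` along `X`, where `sh X` is the
vector field with `J(sh X, Y) = Φ(X, Y)`. -/
def bot (sh : L → L) (S : L →+ A) (X : L) (σ : A) (μ : L → A) (ρ : A) : A :=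
  C.d X ρ + μ (sh X) + σ * S X

section Tractor

variable {S : L →+ A} {sh : L → L} (σ : A) (μ : L →+ A) (ρ : A)

theorem tractor_curv_top (hsym : ∀ X Y, Φ X Y = Φ Y X) (X Y : L) :
    C.top X (C.top Y σ μ) (C.mid Φ Y σ μ ρ) - C.top Y (C.top X σ μ) (C.mid Φ X σ μ ρ)
      - C.top (C.nab X Y - C.nab Y X) σ μ = 2 * C.J X Y * ρ := by
  have h := C.commutator X Y σ
  simp only [top, mid, map_sub, AddMonoidHom.sub_apply, C.skew Y X, hsym Y X] at h ⊢
  linear_combination h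

theorem tractor_curv_mid (X Y Z : L) :
    C.mid Φ X (C.top Y σ μ) (C.mid Φ Y σ μ ρ) (C.bot sh S Y σ μ ρ) Z
      - C.mid Φ Y (C.top X σ μ) (C.mid Φ X σ μ ρ) (C.bot sh S X σ μ ρ) Z
      - C.mid Φ (C.nab X Y - C.nab Y X) σ μ ρ Z =
    - μ (C.curv X Y Z)
      + (C.DForm Φ X Y Z - C.DForm Φ Y X Z + C.J X Z * S Y - C.J Y Z * S X) * σ
      + C.J X Z * μ (sh Y) - C.J Y Z * μ (sh X) - Φ X Z * μ Y + Φ Y Z * μ X := by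
  have h := C.commutator X Y (μ Z)
  simp only [top, mid, bot, DForm, curv, map_sub, map_add, C.d_mul, C.parallel,
    AddMonoidHom.sub_apply] at h ⊢
  linear_combination h

theorem tractor_curv_bot (hsym : ∀ X Y, Φ X Y = Φ Y X) (hsh : ∀ X Y, C.J (sh X) Y = Φ X Y)
    (X Y : L) :
    C.bot sh S X (C.top Y σ μ) (C.mid Φ Y σ μ ρ) (C.bot sh S Y σ μ ρ)
      - C.bot sh S Y (C.top X σ μ) (C.mid Φ X σ μ ρ) (C.bot sh S X σ μ ρ)
      - C.bot sh S (C.nab X Y - C.nab Y X) σ μ ρ =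
    μ (C.nab X (sh Y) - C.nab Y (sh X) - sh (C.nab X Y - C.nab Y X)) - S X * μ Y + S Y * μ X
      + (C.DCov S X Y - Φ X (sh Y) - (C.DCov S Y X - Φ Y (sh X))) * σ := by
  have h := C.commutator X Y ρ
  have h1 : C.J X (sh Y) = - Φ X Y := by rw [C.skew, hsh, hsym]
  have h2 : C.J Y (sh X) = - Φ X Y := by rw [C.skew, hsh]
  simp only [top, mid, bot, DCov, map_sub, map_add, C.d_mul,
    AddMonoidHom.sub_apply, h1, h2] at h ⊢
  linear_combination h

end Tractor

end SymplecticCalculus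

/-! ### Contractions with a symplectic form -/

section Contraction

variable {T ι : Type*} [AddCommGroup T] [Module ℝ T] [Fintype ι] {b : Module.Basis ι ℝ T}
  {J : T →ₗ[ℝ] T →ₗ[ℝ] ℝ} {c : ι → T}

/-! The vectors `c j` with `J (c j) = b.coord j` are the dual basis with raised index, so that
`∑ j, B (c j) (b j)` is the contraction `J^ab B_ab`. -/

theorem sum_basis_mul_form (hc : ∀ j v, J (c j) v = b.coord j v) (f : T →ₗ[ℝ] ℝ) (v : T) :
    ∑ j, f (b j) * J (c j) v = f v := by
  conv_rhs => rw [← b.sum_repr v]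
  simp only [map_sum, map_smul, smul_eq_mul, hc, Module.Basis.coord_apply, mul_comm]

theorem sum_form_smul_dual (hc : ∀ j v, J (c j) v = b.coord j v)
    (skew : ∀ u v, J u v = - J v u) (v : T) : ∑ j, J v (b j) • c j = v := by
  have h (w : T) : J (∑ j, J v (b j) • c j) w = J v w := by
    simpa using sum_basis_mul_form hc (J v) w
  refine b.ext_elem fun i ↦ ?_
  have := h (c i)
  rw [skew, skew v, hc, hc] at this
  simpa using this

theorem sum_dual_mul_form (hc : ∀ j v, J (c j) v = b.coord j v)
    (skew : ∀ u v, J u v = - J v u) (f : T →ₗ[ℝ] ℝ) (v : T) :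
    ∑ j, f (c j) * J v (b j) = f v := by
  conv_rhs => rw [← sum_form_smul_dual hc skew v]
  simp only [map_sum, map_smul, smul_eq_mul, mul_comm]

theorem sum_symm_dual_basis (hc : ∀ j v, J (c j) v = b.coord j v)
    (skew : ∀ u v, J u v = - J v u) (B : T →ₗ[ℝ] T →ₗ[ℝ] ℝ) (hB : ∀ u v, B u v = B v u) :
    ∑ j, B (b j) (c j) = 0 := by
  have h : ∑ j, B (b j) (c j) = ∑ j, ∑ k, J (b j) (b k) * B (c k) (c j) := by
    refine Finset.sum_congr rfl fun j _ ↦ ?_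
    conv_lhs => rw [← sum_form_smul_dual hc skew (b j)]
    simp
  have h' : ∑ j, B (b j) (c j) = - ∑ j, B (b j) (c j) := by
    conv_rhs => rw [h, Finset.sum_comm]
    rw [h, ← Finset.sum_neg_distrib]
    refine Finset.sum_congr rfl fun j _ ↦ ?_
    rw [← Finset.sum_neg_distrib]
    refine Finset.sum_congr rfl fun k _ ↦ ?_
    rw [skew, hB]; ring
  linarith

/-- Contracting the second Bianchi identity determines the skew part of `∇Φ` by its trace. -/
theorem skew_part_of_bianchi (hc : ∀ j v, J (c j) v = b.coord j v)
    (skew : ∀ u v, J u v = - J v u) (C : T →ₗ[ℝ] T →ₗ[ℝ] T →ₗ[ℝ] ℝ)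
    (hC : ∀ u v w, C u v w = C v u w)
    (h : ∀ u v w z t,
      (C w z u * J v t - C v z u * J w t + J v z * C w t u - J w z * C v t u
        + 2 * J v w * C z t u)
      + (C u z v * J w t - C w z v * J u t + J w z * C u t v - J u z * C w t v
        + 2 * J w u * C z t v)
      + (C v z w * J u t - C u z w * J v t + J u z * C v t w - J v z * C u t w
        + 2 * J u v * C z t w) = 0)
    (S : T → ℝ) (hS : ∀ v, ((Fintype.card ι : ℝ) + 1) * S v = ∑ j, C v (c j) (b j)) (u v w : T) :
    C v w u - C u w v = - J u w * S v + J v w * S u - 2 * J u v * S w := by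
  set m : ℝ := (Fintype.card ι : ℝ) with hmdef
  -- contracting over the derivative index and the lowered index
  have key : ∑ j, ((C v w (b j) * J u (c j) - C u w (b j) * J v (c j) + J u w * C v (c j) (b j)
        - J v w * C u (c j) (b j) + 2 * J u v * C w (c j) (b j))
      + (C (b j) w u * J v (c j) - C v w u * J (b j) (c j) + J v w * C (b j) (c j) u
        - J (b j) w * C v (c j) u + 2 * J v (b j) * C w (c j) u)
      + (C u w v * J (b j) (c j) - C (b j) w v * J u (c j) + J (b j) w * C u (c j) v
        - J u w * C (b j) (c j) v + 2 * J (b j) u * C w (c j) v)) = 0 :=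
    Finset.sum_eq_zero fun j _ ↦ h (b j) u v w (c j)
  have ra (f : T →ₗ[ℝ] ℝ) (v : T) : ∑ j, f (b j) * J v (c j) = - f v := by
    rw [← sum_basis_mul_form hc f v, ← Finset.sum_neg_distrib]
    exact Finset.sum_congr rfl fun j _ ↦ by rw [skew v]; ring
  have rb (f : T →ₗ[ℝ] ℝ) (v : T) : ∑ j, J (b j) v * f (c j) = - f v := by
    rw [← sum_dual_mul_form hc skew f v, ← Finset.sum_neg_distrib]
    exact Finset.sum_congr rfl fun j _ ↦ by rw [skew v]; ring
  have rb' (f : T →ₗ[ℝ] ℝ) (v : T) : ∑ j, J v (b j) * f (c j) = f v := by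
    rw [← sum_dual_mul_form hc skew f v]
    exact Finset.sum_congr rfl fun j _ ↦ by ring
  have rc : ∑ j, J (b j) (c j) = - m := by
    simp [skew (b _) (c _), hc, m]
  have e1 := ra (C v w) u
  have e2 := ra (C u w) v
  have e3 := ra ((C.flip w).flip u) v
  have e4 := ra ((C.flip w).flip v) u
  have e5 := sum_symm_dual_basis hc skew (LinearMap.compr₂ C (LinearMap.applyₗ u))
    (fun x y ↦ hC x y u)
  have e6 := sum_symm_dual_basis hc skew (LinearMap.compr₂ C (LinearMap.applyₗ v))
    (fun x y ↦ hC x y v)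
  have e7 := rb ((C v).flip u) w
  have e8 := rb ((C u).flip v) w
  have e9 := rb' ((C w).flip u) v
  have e10 := rb ((C w).flip v) u
  simp only [LinearMap.flip_apply, LinearMap.compr₂_apply, LinearMap.applyₗ_apply_apply]
    at e1 e2 e3 e4 e5 e6 e7 e8 e9 e10
  simp only [Finset.sum_add_distrib, Finset.sum_sub_distrib, mul_assoc, ← Finset.mul_sum, e1, e2,
    e3, e4, e5, e6, e7, e8, e9, e10, rc, ← hS] at key
  have hm : m + 1 ≠ 0 := by positivity
  apply mul_left_cancel₀ hm
  rw [hC v w, hC u w] at key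
  rw [hC u w]
  linear_combination key + (m + 1) * hC v w u

/-- Contracting the Ricci identity for `Φ` shows that the skew part of `N` is a multiple of `J`. -/
theorem skew_part_eq_form (hc : ∀ j v, J (c j) v = b.coord j v)
    (skew : ∀ u v, J u v = - J v u) (N : T →ₗ[ℝ] T →ₗ[ℝ] ℝ)
    (h : ∀ e x y z, J e z * (N x y - N y x) + J x z * (N y e - N e y) + J y z * (N e x - N x e) =
      2 * (J e x * N y z + J x y * N e z + J y e * N x z)) (x y : T) :
    N x y - N y x = 2 * J x y * ((∑ j, N (c j) (b j)) / Fintype.card ι) := by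
  set m : ℝ := (Fintype.card ι : ℝ) with hmdef
  have key : ∑ j, (J (c j) (b j) * (N x y - N y x) + J x (b j) * (N y (c j) - N (c j) y)
      + J y (b j) * (N (c j) x - N x (c j))) =
      ∑ j, 2 * (J (c j) x * N y (b j) + J x y * N (c j) (b j) + J y (c j) * N x (b j)) :=
    Finset.sum_congr rfl fun j _ ↦ h (c j) x y (b j)
  rcases isEmpty_or_nonempty ι with hι | hι
  · have hx : x = 0 := b.ext_elem fun i ↦ hι.elim i
    simp [hx]
  have hm : m ≠ 0 := by simp [m]
  have e0 : ∑ j, J (c j) (b j) = m := by simp [hc, m]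
  have e1 (f : T →ₗ[ℝ] ℝ) (v : T) : ∑ j, J v (b j) * f (c j) = f v := by
    rw [← sum_dual_mul_form hc skew f v]
    exact Finset.sum_congr rfl fun j _ ↦ by ring
  have e2 (f : T →ₗ[ℝ] ℝ) (v : T) : ∑ j, J (c j) v * f (b j) = f v := by
    rw [← sum_basis_mul_form hc f v]
    exact Finset.sum_congr rfl fun j _ ↦ by ring
  have e3 (f : T →ₗ[ℝ] ℝ) (v : T) : ∑ j, J v (c j) * f (b j) = - f v := by
    rw [← e2, ← Finset.sum_neg_distrib]
    exact Finset.sum_congr rfl fun j _ ↦ by rw [skew v]; ring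
  have e1' (v w : T) := e1 (N.flip v) w
  simp only [LinearMap.flip_apply] at e1'
  simp only [mul_sub, Finset.sum_add_distrib, Finset.sum_sub_distrib, ← Finset.sum_mul,
    ← Finset.mul_sum, e0, e1, e1', e2, e3] at key
  field_simp
  linear_combination key

end Contraction

/-! ### Coordinate frames and locality -/

section Calculus

variable {n : ℕ} {M : Type u} [TopologicalSpace M] [ChartedSpace (Model n) M]
  [IsManifold (𝓡 (2 * n)) ∞ M]

/-- The basis of the model fibre corresponding to the coordinate basis at `x` under the preferred
trivialization of the tangent bundle at `x`. -/
def modelBasis (x : M) : Module.Basis (Fin (2 * n)) ℝ (Model n) :=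
  (coordBasis x).map
    ((trivializationAt (Model n) (TangentSpace (𝓡 (2 * n)) : M → Type) x).linearEquivAt ℝ x
      (FiberBundle.mem_baseSet_trivializationAt (Model n) (TangentSpace (𝓡 (2 * n)) : M → Type) x))

theorem localFrame_modelBasis (x : M) {y : M}
    (hy : y ∈ (trivializationAt (Model n) (TangentSpace (𝓡 (2 * n)) : M → Type) x).baseSet)
    (i : Fin (2 * n)) :
    (trivializationAt (Model n) (TangentSpace (𝓡 (2 * n)) : M → Type) x).localFrame
      (modelBasis x) i y = coordField x i y := by
  rw [Trivialization.localFrame_apply_of_mem_baseSet _ _ hy]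
  simp [modelBasis, coordField, FiberBundle.extend, Trivialization.basisAt]

theorem coordField_self (x : M) (i : Fin (2 * n)) : coordField x i x = coordBasis x i := by
  simp [coordField]

theorem mdifferentiableAt_coordField (x : M) (i : Fin (2 * n)) :
    MDifferentiableAt (𝓡 (2 * n)) ((𝓡 (2 * n)).prod 𝓘(ℝ, Model n))
      (fun y ↦ TotalSpace.mk' (Model n) y (coordField x i y)) x :=
  FiberBundle.mdifferentiableAt_extend ..

variable [T2Space M]

/-- Global vector fields which near `x` are the coordinate fields of the preferred chart. -/
theorem exists_coordFrame (x : M) :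
    ∃ fr : CutoffFrame (𝓡 (2 * n)) (Model n) (TangentSpace (𝓡 (2 * n)) : M → Type) (modelBasis x) x,
      (∀ᶠ y in 𝓝 x, ∀ i, fr.e i y = coordField x i y) ∧ (∀ i, fr.e i x = coordBasis x i) ∧
      ∀ i, fr.θ i x = (coordBasis x).coord i := by
  obtain ⟨fr⟩ := nonempty_cutoffFrame (I := 𝓡 (2 * n))
    (V := (TangentSpace (𝓡 (2 * n)) : M → Type)) (modelBasis (n := n) x) x
  have h1 : ∀ᶠ y in 𝓝 x, ∀ i, fr.e i y = coordField x i y := by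
    filter_upwards [fr.eventually_eq,
      (trivializationAt (Model n) (TangentSpace (𝓡 (2 * n)) : M → Type) x).open_baseSet.mem_nhds
      (FiberBundle.mem_baseSet_trivializationAt (Model n)
        (TangentSpace (𝓡 (2 * n)) : M → Type) x)] with y hy hy' i
    rw [hy, localFrame_modelBasis x hy']
  have h2 (i) : fr.e i x = coordBasis x i := by rw [h1.self_of_nhds, coordField_self]
  refine ⟨fr, h1, h2, fun i ↦ ?_⟩
  obtain ⟨B, hB, hB'⟩ := fr.eventually_basis.self_of_nhds
  rw [← hB' i]
  congr 1
  exact Module.Basis.eq_of_apply_eq fun i ↦ by rw [hB, h2]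

theorem tensorial_eq_sum_coord {x : M}
    {fr : CutoffFrame (𝓡 (2 * n)) (Model n) (TangentSpace (𝓡 (2 * n)) : M → Type) (modelBasis x) x}
    (hfr : ∀ i, fr.θ i x = (coordBasis x).coord i)
    {A : Type*} [AddCommGroup A] [Module ℝ A]
    (Q : (Π y : M, TangentSpace (𝓡 (2 * n)) y) → A)
    (hadd : ∀ s t, IsSmoothSection n (Model n) s → IsSmoothSection n (Model n) t →
      Q (s + t) = Q s + Q t)
    (hsmul : ∀ (f : M → ℝ) s, ContMDiff (𝓡 (2 * n)) 𝓘(ℝ) ∞ f →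
      IsSmoothSection n (Model n) s → Q (f • s) = f x • Q s)
    {s : Π y : M, TangentSpace (𝓡 (2 * n)) y} (hs : IsSmoothSection n (Model n) s) :
    Q s = (coordBasis x).constr ℝ (fun i ↦ Q (fr.e i)) (s x) := by
  rw [fr.tensorial_eq_sum Q hadd hsmul hs, Module.Basis.constr_apply_fintype]
  simp [hfr]

variable {cov : AffineConnection n M}

theorem isSmoothSection_cov (hcov : CovariantDerivative.ContMDiffCovariantDerivative cov ∞)
    {X Y : Π x : M, TangentSpace (𝓡 (2 * n)) x} (hX : IsSmoothSection n (Model n) X)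
    (hY : IsSmoothSection n (Model n) Y) :
    IsSmoothSection n (Model n) (fun y ↦ cov Y y (X y)) := by
  have h := contMDiffOn_univ.1 (hcov.contMDiff.contMDiff (σ := Y) (by simpa using! hY.contMDiffOn))
  exact h.clm_bundle_apply hX

theorem cov_congr (cov : AffineConnection n M) {x : M} {Y Y' : Π x : M, TangentSpace (𝓡 (2 * n)) x}
    (hY : IsSmoothSection n (Model n) Y) (h : ∀ᶠ y in 𝓝 x, Y y = Y' y) : cov Y x = cov Y' x := by
  have h1 := (hY x).mdifferentiableAt (by simp)
  refine cov.isCovariantDerivativeOnUniv.congr_of_eventuallyEq h1 ?_ Filter.univ_mem h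
  refine h1.congr_of_eventuallyEq ?_
  filter_upwards [h] with y hy
  rw [hy]

theorem mvfderiv_congr {x : M} {f g : M → ℝ} (h : f =ᶠ[𝓝 x] g) :
    mvfderiv (𝓡 (2 * n)) f x = mvfderiv (𝓡 (2 * n)) g x := by
  ext v
  simp only [mvfderiv, h.mfderiv_eq]
  rfl

theorem curvature_congr (hcov : CovariantDerivative.ContMDiffCovariantDerivative cov ∞) {x : M}
    {X Y Z X' Y' Z' : Π x : M, TangentSpace (𝓡 (2 * n)) x} (hX : IsSmoothSection n (Model n) X)
    (hY : IsSmoothSection n (Model n) Y) (hZ : IsSmoothSection n (Model n) Z)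
    (hXX' : ∀ᶠ y in 𝓝 x, X y = X' y) (hYY' : ∀ᶠ y in 𝓝 x, Y y = Y' y)
    (hZZ' : ∀ᶠ y in 𝓝 x, Z y = Z' y) :
    curvature cov X Y Z x = curvature cov X' Y' Z' x := by
  have hZ' : ∀ᶠ y in 𝓝 x, cov Z y = cov Z' y := by
    filter_upwards [hZZ'.eventually_nhds] with y hy using cov_congr cov hZ hy
  unfold curvature
  rw [cov_congr cov (isSmoothSection_cov hcov hY hZ) (Y' := fun y ↦ cov Z' y (Y' y)),
    cov_congr cov (isSmoothSection_cov hcov hX hZ) (Y' := fun y ↦ cov Z' y (X' y)),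
    hXX'.self_of_nhds, hYY'.self_of_nhds, hZ'.self_of_nhds,
    Filter.EventuallyEq.mlieBracket_vectorField_eq hXX' hYY']
  · filter_upwards [hZ', hXX'] with y h1 h2
    rw [h1, h2]
  · filter_upwards [hZ', hYY'] with y h1 h2
    rw [h1, h2]

end Calculus

/-! ### Tensors computed from vector fields -/

section Curvature

variable {n : ℕ} {M : Type u} [TopologicalSpace M] [ChartedSpace (Model n) M]
  [IsManifold (𝓡 (2 * n)) ∞ M] [T2Space M] {cov : AffineConnection n M}
  {X Y Z X' Y' Z' : Π x : M, TangentSpace (𝓡 (2 * n)) x} {f : M → ℝ}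

theorem cov_add (cov : AffineConnection n M) (hY : IsSmoothSection n (Model n) Y)
    (hY' : IsSmoothSection n (Model n) Y') (x : M) : cov (Y + Y') x = cov Y x + cov Y' x :=
  cov.isCovariantDerivativeOnUniv.add ((hY x).mdifferentiableAt (by simp))
    ((hY' x).mdifferentiableAt (by simp))

theorem cov_smul (cov : AffineConnection n M) (hf : ContMDiff (𝓡 (2 * n)) 𝓘(ℝ) ∞ f)
    (hY : IsSmoothSection n (Model n) Y) (x : M) :
    cov (f • Y) x = f x • cov Y x + (mvfderiv (𝓡 (2 * n)) f x).smulRight (Y x) :=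
  cov.isCovariantDerivativeOnUniv.leibniz ((hY x).mdifferentiableAt (by simp))
    ((hf x).mdifferentiableAt (by simp))

theorem isSmoothSection_curvature (hcov : CovariantDerivative.ContMDiffCovariantDerivative cov ∞)
    (hX : IsSmoothSection n (Model n) X)
    (hY : IsSmoothSection n (Model n) Y) (hZ : IsSmoothSection n (Model n) Z) :
    IsSmoothSection n (Model n) (curvature cov X Y Z) :=
  ((isSmoothSection_cov hcov hX (isSmoothSection_cov hcov hY hZ)).sub_section
    (isSmoothSection_cov hcov hY (isSmoothSection_cov hcov hX hZ))).sub_section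
    (isSmoothSection_cov hcov (isSmoothSection_mlieBracket hX hY) hZ)

theorem curvature_add_right (hcov : CovariantDerivative.ContMDiffCovariantDerivative cov ∞)
    (hX : IsSmoothSection n (Model n) X) (hY : IsSmoothSection n (Model n) Y)
    (hZ : IsSmoothSection n (Model n) Z) (hZ' : IsSmoothSection n (Model n) Z') (x : M) :
    curvature cov X Y (Z + Z') x = curvature cov X Y Z x + curvature cov X Y Z' x := by
  have h (X : Π x : M, TangentSpace (𝓡 (2 * n)) x) : (fun y ↦ cov (Z + Z') y (X y)) =
      (fun y ↦ cov Z y (X y)) + fun y ↦ cov Z' y (X y) := by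
    ext1 y; simp [cov_add cov hZ hZ']
  unfold curvature
  rw [h, h, cov_add cov (isSmoothSection_cov hcov hY hZ) (isSmoothSection_cov hcov hY hZ'),
    cov_add cov (isSmoothSection_cov hcov hX hZ) (isSmoothSection_cov hcov hX hZ'),
    cov_add cov hZ hZ']
  simp only [add_apply]
  abel

theorem curvature_smul_right (hcov : CovariantDerivative.ContMDiffCovariantDerivative cov ∞)
    (hX : IsSmoothSection n (Model n) X) (hY : IsSmoothSection n (Model n) Y)
    (hf : ContMDiff (𝓡 (2 * n)) 𝓘(ℝ) ∞ f) (hZ : IsSmoothSection n (Model n) Z) (x : M) :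
    curvature cov X Y (f • Z) x = f x • curvature cov X Y Z x := by
  have h (X : Π x : M, TangentSpace (𝓡 (2 * n)) x) : (fun y ↦ cov (f • Z) y (X y)) =
      f • (fun y ↦ cov Z y (X y)) + (fun y ↦ mvfderiv (𝓡 (2 * n)) f y (X y)) • Z := by
    ext1 y; simp [cov_smul cov hf hZ]
  have hXf := contMDiff_mvfderiv_apply hX hf
  have hYf := contMDiff_mvfderiv_apply hY hf
  have hc := commutator_mvfderiv hX hY hf x
  unfold curvature
  rw [h, h, cov_add cov (hf.smul_section (isSmoothSection_cov hcov hY hZ)) (hYf.smul_section hZ),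
    cov_add cov (hf.smul_section (isSmoothSection_cov hcov hX hZ)) (hXf.smul_section hZ),
    cov_smul cov hf hZ, cov_smul cov hf (isSmoothSection_cov hcov hY hZ),
    cov_smul cov hf (isSmoothSection_cov hcov hX hZ), cov_smul cov hYf hZ, cov_smul cov hXf hZ]
  simp only [add_apply, smul_apply, ContinuousLinearMap.smulRight_apply, ← hc]
  module

theorem curvature_add_left (hcov : CovariantDerivative.ContMDiffCovariantDerivative cov ∞)
    (hX : IsSmoothSection n (Model n) X) (hX' : IsSmoothSection n (Model n) X')
    (hZ : IsSmoothSection n (Model n) Z) (x : M) :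
    curvature cov (X + X') Y Z x = curvature cov X Y Z x + curvature cov X' Y Z x := by
  have h : (fun y ↦ cov Z y ((X + X') y)) =
      (fun y ↦ cov Z y (X y)) + fun y ↦ cov Z y (X' y) := by
    ext1 y; simp
  unfold curvature
  rw [h, cov_add cov (isSmoothSection_cov hcov hX hZ) (isSmoothSection_cov hcov hX' hZ),
    VectorField.mlieBracket_add_left ((hX x).mdifferentiableAt (by simp))
      ((hX' x).mdifferentiableAt (by simp))]
  simp only [Pi.add_apply, map_add, add_apply]
  abel

theorem curvature_smul_left (hcov : CovariantDerivative.ContMDiffCovariantDerivative cov ∞)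
    (hX : IsSmoothSection n (Model n) X)
    (hf : ContMDiff (𝓡 (2 * n)) 𝓘(ℝ) ∞ f) (hZ : IsSmoothSection n (Model n) Z) (x : M) :
    curvature cov (f • X) Y Z x = f x • curvature cov X Y Z x := by
  have h : (fun y ↦ cov Z y ((f • X) y)) = f • (fun y ↦ cov Z y (X y)) := by
    ext1 y; simp
  unfold curvature
  rw [h, cov_smul cov hf (isSmoothSection_cov hcov hX hZ),
    VectorField.mlieBracket_smul_left ((hf x).mdifferentiableAt (by simp))
      ((hX x).mdifferentiableAt (by simp))]
  simp only [Pi.smul_apply', map_add, add_apply, map_smul, smul_apply,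
    ContinuousLinearMap.smulRight_apply]
  module

theorem curvature_swap (X Y Z : Π x : M, TangentSpace (𝓡 (2 * n)) x) (x : M) :
    curvature cov X Y Z x = - curvature cov Y X Z x := by
  unfold curvature
  rw [VectorField.mlieBracket_swap_apply, map_neg]
  abel

/-- The curvature tensor computes the curvature of vector fields. -/
theorem curvatureTensor_apply (hcov : CovariantDerivative.ContMDiffCovariantDerivative cov ∞)
    (hX : IsSmoothSection n (Model n) X)
    (hY : IsSmoothSection n (Model n) Y) (hZ : IsSmoothSection n (Model n) Z) (x : M) :
    curvatureTensor cov x (X x) (Y x) (Z x) = curvature cov X Y Z x := by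
  obtain ⟨fr, h1, h2, h3⟩ := exists_coordFrame (n := n) x
  have hZZ (X Y) (hX : IsSmoothSection n (Model n) X) (hY : IsSmoothSection n (Model n) Y) :=
    tensorial_eq_sum_coord h3 (fun Z ↦ curvature cov X Y Z x)
      (fun _ _ hs ht ↦ curvature_add_right hcov hX hY hs ht x)
      (fun f _ hf hs ↦ curvature_smul_right hcov hX hY hf hs x) hZ
  have hYY (X Z) (hX : IsSmoothSection n (Model n) X) (hZ : IsSmoothSection n (Model n) Z) :=
    tensorial_eq_sum_coord h3 (fun Y ↦ curvature cov X Y Z x)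
      (fun s t hs ht ↦ by
        simp only [curvature_swap X]; rw [curvature_add_left hcov hs ht hZ, neg_add])
      (fun f s hf hs ↦ by
        simp only [curvature_swap X]; rw [curvature_smul_left hcov hs hf hZ, smul_neg]) hY
  have hXX (Y Z) (hZ : IsSmoothSection n (Model n) Z) :=
    tensorial_eq_sum_coord h3 (fun X ↦ curvature cov X Y Z x)
      (fun s t hs ht ↦ curvature_add_left hcov hs ht hZ x)
      (fun f s hf hs ↦ curvature_smul_left hcov hs hf hZ x) hX
  rw [hXX Y Z hZ, curvatureTensor]
  have e (i) : curvature cov (fr.e i) Y Z x =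
    ((coordBasis x).constr ℝ fun j ↦ (coordBasis x).constr ℝ fun k ↦
      curvature cov (coordField x i) (coordField x j) (coordField x k) x) (Y x) (Z x) := by
    rw [hYY _ _ (fr.smooth_e i) hZ]
    have e' (j) : curvature cov (fr.e i) (fr.e j) Z x =
        ((coordBasis x).constr ℝ fun k ↦
        curvature cov (coordField x i) (coordField x j) (coordField x k) x) (Z x) := by
      rw [hZZ _ _ (fr.smooth_e i) (fr.smooth_e j)]
      congr 2
      ext1 k
      exact curvature_congr hcov (fr.smooth_e i) (fr.smooth_e j) (fr.smooth_e k)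
        (h1.mono fun y hy ↦ hy i) (h1.mono fun y hy ↦ hy j) (h1.mono fun y hy ↦ hy k)
    simp only [e', Module.Basis.constr_apply_fintype, LinearMap.sum_apply, LinearMap.smul_apply]
  simp only [e, Module.Basis.constr_apply_fintype, LinearMap.sum_apply, LinearMap.smul_apply]

variable {Φ : Π x : M, TangentSpace (𝓡 (2 * n)) x →L[ℝ] TangentSpace (𝓡 (2 * n)) x →L[ℝ] ℝ}

/-- A family of bilinear forms is smooth if its values on smooth vector fields are smooth
functions. -/
def IsSmoothForm
    (Φ : Π x : M, TangentSpace (𝓡 (2 * n)) x →L[ℝ] TangentSpace (𝓡 (2 * n)) x →L[ℝ] ℝ) : Prop :=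
  ∀ Y, IsSmoothSection n (Model n) Y → IsSmoothCovector fun x ↦ Φ x (Y x)

theorem covDerivForm_apply (hΦ : IsSmoothForm Φ) (cov : AffineConnection n M)
    (hY : IsSmoothSection n (Model n) Y) (hZ : IsSmoothSection n (Model n) Z) (x : M)
    (w : TangentSpace (𝓡 (2 * n)) x) :
    covDerivForm cov Φ x (Y x) (Z x) w =
      mvfderiv (𝓡 (2 * n)) (fun y ↦ Φ y (Y y) (Z y)) x w - Φ x (cov Y x w) (Z x)
        - Φ x (Y x) (cov Z x w) := by
  obtain ⟨fr, h1, h2, h3⟩ := exists_coordFrame (n := n) x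
  have hd {Y Z} (hY : IsSmoothSection n (Model n) Y) (hZ : IsSmoothSection n (Model n) Z) :
      MDifferentiableAt (𝓡 (2 * n)) 𝓘(ℝ) (fun y ↦ Φ y (Y y) (Z y)) x :=
    (hΦ Y hY Z hZ x).mdifferentiableAt (by simp)
  set Q := fun Y Z ↦ mvfderiv (𝓡 (2 * n)) (fun y ↦ Φ y (Y y) (Z y)) x w - Φ x (cov Y x w) (Z x)
        - Φ x (Y x) (cov Z x w) with hQ
  have hYY {Y Z} (hY : IsSmoothSection n (Model n) Y) (hZ : IsSmoothSection n (Model n) Z) :=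
    tensorial_eq_sum_coord h3 (fun Y ↦ Q Y Z)
      (fun s t hs ht ↦ by
        have : (fun y ↦ Φ y ((s + t) y) (Z y)) =
          (fun y ↦ Φ y (s y) (Z y)) + (fun y ↦ Φ y (t y) (Z y)) := by ext y; simp
        simp only [hQ, this, mvfderiv_add (hd hs hZ) (hd ht hZ), cov_add cov hs ht]
        simp only [add_apply, map_add, Pi.add_apply]
        ring)
      (fun f s hf hs ↦ by
        have : (fun y ↦ Φ y ((f • s) y) (Z y)) = f * (fun y ↦ Φ y (s y) (Z y)) := by ext y; simp
        simp only [hQ, this, mvfderiv_mul ((hf x).mdifferentiableAt (by simp)) (hd hs hZ),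
          cov_smul cov hf hs]
        simp only [add_apply, map_add, Pi.smul_apply', smul_apply, map_smul, smul_eq_mul,
          ContinuousLinearMap.smulRight_apply]
        ring) hY
  have hZZ {Y Z} (hY : IsSmoothSection n (Model n) Y) (hZ : IsSmoothSection n (Model n) Z) :=
    tensorial_eq_sum_coord h3 (fun Z ↦ Q Y Z)
      (fun s t hs ht ↦ by
        have : (fun y ↦ Φ y (Y y) ((s + t) y)) =
          (fun y ↦ Φ y (Y y) (s y)) + (fun y ↦ Φ y (Y y) (t y)) := by ext y; simp
        simp only [hQ, this, mvfderiv_add (hd hY hs) (hd hY ht), cov_add cov hs ht]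
        simp only [add_apply, map_add, Pi.add_apply]
        ring)
      (fun f s hf hs ↦ by
        have : (fun y ↦ Φ y (Y y) ((f • s) y)) = f * (fun y ↦ Φ y (Y y) (s y)) := by ext y; simp
        simp only [hQ, this, mvfderiv_mul ((hf x).mdifferentiableAt (by simp)) (hd hY hs),
          cov_smul cov hf hs]
        simp only [add_apply, map_add, Pi.smul_apply', smul_apply, map_smul, smul_eq_mul,
          ContinuousLinearMap.smulRight_apply]
        ring) hZ
  change _ = Q Y Z
  rw [hYY hY hZ]
  simp only [hZZ (fr.smooth_e _) hZ]
  have e (i j) : Q (fr.e i) (fr.e j) =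
      mvfderiv (𝓡 (2 * n)) (fun y ↦ Φ y (coordField x i y) (coordField x j y)) x w
          - Φ x (cov (coordField x i) x w) (coordBasis x j)
          - Φ x (coordBasis x i) (cov (coordField x j) x w) := by
    simp only [hQ, h2]
    rw [cov_congr cov (fr.smooth_e i) (h1.mono fun y hy ↦ hy i),
      cov_congr cov (fr.smooth_e j) (h1.mono fun y hy ↦ hy j), mvfderiv_congr]
    filter_upwards [h1] with y hy
    rw [hy, hy]
  simp only [e, covDerivForm, Module.Basis.constr_apply_fintype, LinearMap.sum_apply,
    LinearMap.smul_apply, LinearMap.coe_mk, AddHom.coe_mk]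

variable {μ : Π x : M, TangentSpace (𝓡 (2 * n)) x →L[ℝ] ℝ}

theorem covDerivCovector_apply (hμ : IsSmoothCovector μ) (cov : AffineConnection n M)
    (hY : IsSmoothSection n (Model n) Y) (x : M) (w : TangentSpace (𝓡 (2 * n)) x) :
    covDerivCovector cov μ x w (Y x) =
      mvfderiv (𝓡 (2 * n)) (fun y ↦ μ y (Y y)) x w - μ x (cov Y x w) := by
  obtain ⟨fr, h1, h2, h3⟩ := exists_coordFrame (n := n) x
  have hd {Y} (hY : IsSmoothSection n (Model n) Y) :
      MDifferentiableAt (𝓡 (2 * n)) 𝓘(ℝ) (fun y ↦ μ y (Y y)) x :=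
    (hμ Y hY x).mdifferentiableAt (by simp)
  set Q := fun Y ↦ mvfderiv (𝓡 (2 * n)) (fun y ↦ μ y (Y y)) x w - μ x (cov Y x w) with hQ
  have hYY :=
    tensorial_eq_sum_coord h3 (fun Y ↦ Q Y)
      (fun s t hs ht ↦ by
        have : (fun y ↦ μ y ((s + t) y)) =
          (fun y ↦ μ y (s y)) + (fun y ↦ μ y (t y)) := by ext y; simp
        simp only [hQ, this, mvfderiv_add (hd hs) (hd ht), cov_add cov hs ht]
        simp only [add_apply, map_add]
        ring)
      (fun f s hf hs ↦ by
        have : (fun y ↦ μ y ((f • s) y)) = f * (fun y ↦ μ y (s y)) := by ext y; simp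
        simp only [hQ, this, mvfderiv_mul ((hf x).mdifferentiableAt (by simp)) (hd hs),
          cov_smul cov hf hs]
        simp only [add_apply, map_add, smul_apply, map_smul, smul_eq_mul,
          ContinuousLinearMap.smulRight_apply]
        ring) hY
  change _ = Q Y
  rw [hYY]
  have e (i) : Q (fr.e i) =
      mvfderiv (𝓡 (2 * n)) (fun y ↦ μ y (coordField x i y)) x w
        - μ x (cov (coordField x i) x w) := by
    simp only [hQ]
    rw [cov_congr cov (fr.smooth_e i) (h1.mono fun y hy ↦ hy i), mvfderiv_congr]
    filter_upwards [h1] with y hy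
    rw [hy]
  simp only [e, covDerivCovector, LinearMap.toContinuousBilinearMap_apply, LinearMap.flip_apply]
  simp only [Module.Basis.constr_apply_fintype, LinearMap.sum_apply,
    LinearMap.smul_apply, LinearMap.coe_mk, AddHom.coe_mk]

end Curvature

/-! ### Contraction and raising of indices for smooth tensors -/

section Trace

variable {T T' A ι κ : Type*} [AddCommGroup T] [Module ℝ T] [AddCommGroup T'] [Module ℝ T']
  [AddCommGroup A] [Module ℝ A] [Fintype ι] [Fintype κ]

/-- The contraction of a vector with a covector argument does not depend on the basis. -/
theorem sum_apply_coord_eq (b : Module.Basis ι ℝ T) (b' : Module.Basis κ ℝ T') (e : T ≃ₗ[ℝ] T')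
    (G : T →ₗ[ℝ] (T →ₗ[ℝ] ℝ) →ₗ[ℝ] A) (G' : T' → (T' →ₗ[ℝ] ℝ) → A)
    (h : ∀ v α, G v (α ∘ₗ e.toLinearMap) = G' (e v) α) :
    ∑ i, G (b i) (b.coord i) = ∑ k, G' (b' k) (b'.coord k) := by
  have h1 (k : κ) : G' (b' k) (b'.coord k) =
      ∑ i, b.coord i (e.symm (b' k)) • G (b i) (b'.coord k ∘ₗ e.toLinearMap) := by
    conv_lhs => rw [← e.apply_symm_apply (b' k), ← h]
    conv_lhs => enter [1]; rw [← b.sum_repr (e.symm (b' k)), map_sum]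
    simp
  have h2 (i : ι) : b.coord i = ∑ k, b.coord i (e.symm (b' k)) • (b'.coord k ∘ₗ e.toLinearMap) := by
    ext v
    have := congr(b.coord i (e.symm $(b'.sum_repr (e v))))
    rw [e.symm_apply_apply] at this
    rw [← this]
    simp only [map_sum, map_smul, LinearMap.sum_apply, LinearMap.smul_apply, smul_eq_mul,
      LinearMap.comp_apply, Module.Basis.coord_apply, LinearEquiv.coe_coe, mul_comm]
  simp_rw [h1]
  rw [Finset.sum_comm]
  refine Finset.sum_congr rfl fun i _ ↦ ?_
  conv_lhs => rw [h2]
  simp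
end Trace

section Smooth

variable {n : ℕ} {M : Type u} [TopologicalSpace M] [ChartedSpace (Model n) M]
  [IsManifold (𝓡 (2 * n)) ∞ M] [T2Space M]

theorem sharp_form (J : SymplecticForm n M) (x : M) (v : TangentSpace (𝓡 (2 * n)) x) :
    J.sharp x (J.form x v) = v := by
  rw [← sub_eq_zero]
  exact J.nondegenerate x _ fun w ↦ by simp [J.form_sharp]

theorem form_isInvertible (J : SymplecticForm n M) (x : M) : (J.form x).IsInvertible :=
  ContinuousLinearMap.IsInvertible.of_inverse (ContinuousLinearMap.ext (J.form_sharp x))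
    (ContinuousLinearMap.ext (sharp_form J x))

/-- The contraction of a vector with a covector argument of a smooth family is smooth. -/
theorem contMDiff_contraction
    (G : Π x : M, TangentSpace (𝓡 (2 * n)) x →ₗ[ℝ] (TangentSpace (𝓡 (2 * n)) x →ₗ[ℝ] ℝ) →ₗ[ℝ] ℝ)
    (hG : ∀ (Y : Π x : M, TangentSpace (𝓡 (2 * n)) x)
      (μ : Π x : M, TangentSpace (𝓡 (2 * n)) x →ₗ[ℝ] ℝ), IsSmoothSection n (Model n) Y →
      IsSmoothCovector (fun x ↦ LinearMap.toContinuousLinearMap (μ x)) →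
      ContMDiff (𝓡 (2 * n)) 𝓘(ℝ) ∞ fun x ↦ G x (Y x) (μ x)) :
    ContMDiff (𝓡 (2 * n)) 𝓘(ℝ) ∞ fun x ↦ ∑ i, G x (coordBasis x i) ((coordBasis x).coord i) := by
  intro x
  obtain ⟨fr⟩ := nonempty_cutoffFrame (I := 𝓡 (2 * n))
    (V := (TangentSpace (𝓡 (2 * n)) : M → Type)) (Module.finBasis ℝ (Model n)) x
  have h (i) := hG (fr.e i) (fr.θ i) (fr.smooth_e i) (fr.smooth_θ i)
  refine (ContMDiff.sum (t := Finset.univ) fun i _ ↦ h i).contMDiffAt.congr_of_eventuallyEq ?_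
  filter_upwards [fr.eventually_basis] with y ⟨B, hB, hB'⟩
  simp only [← hB, ← hB']
  exact sum_apply_coord_eq _ _ (LinearEquiv.refl ℝ _) (G y) (fun v α ↦ G y v α) fun v α ↦ rfl

open ContinuousLinearMap in
/-- Raising the index is smooth, since inversion is smooth at an invertible map. -/
theorem isSmoothSection_sharp (J : SymplecticForm n M)
    {μ : Π x : M, TangentSpace (𝓡 (2 * n)) x →L[ℝ] ℝ} (hμ : IsSmoothCovector μ) :
    IsSmoothSection n (Model n) fun x ↦ J.sharp x (μ x) := by
  intro x₀
  have hJ := (contMDiffAt_hom_bundle (IB := 𝓡 (2 * n)) (n := ∞) (x₀ := x₀)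
    (E₂ := fun x : M ↦ TangentSpace (𝓡 (2 * n)) x →L[ℝ] Bundle.Trivial M ℝ x)
    (F₂ := Model n →L[ℝ] ℝ) _).1 (J.smooth x₀)
  have h2 : ContMDiffAt (𝓡 (2 * n)) 𝓘(ℝ, (Model n →L[ℝ] ℝ) →L[ℝ] Model n) ∞
      (ContinuousLinearMap.inverse ∘ (fun (x : M) ↦ ContinuousLinearMap.inCoordinates
        (Model n) (TangentSpace (𝓡 (2 * n)) (M := M)) (Model n →L[ℝ] ℝ)
        (fun x : M ↦ TangentSpace (𝓡 (2 * n)) x →L[ℝ] Bundle.Trivial M ℝ x)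
        x₀ x x₀ x (J.form x))) x₀ := by
    refine ContMDiffAt.comp x₀ ?_ hJ.2
    apply ContDiffAt.contMDiffAt
    apply IsInvertible.contDiffAt_map_inverse
    rw [inCoordinates_eq (FiberBundle.mem_baseSet_trivializationAt' x₀)
      (FiberBundle.mem_baseSet_trivializationAt' x₀)]
    exact isInvertible_equiv.comp ((form_isInvertible J x₀).comp isInvertible_equiv)
  refine ContMDiffAt.clm_apply_of_inCoordinates (b₁ := id) (b₂ := id) (ϕ := fun x ↦ J.sharp x)
    (E₁ := fun x : M ↦ TangentSpace (𝓡 (2 * n)) x →L[ℝ] Bundle.Trivial M ℝ x)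
    (h2.congr_of_eventuallyEq ?_) (contMDiff_covector_iff.2 hμ x₀) contMDiffAt_id
  filter_upwards [(trivializationAt (Model n)
    (TangentSpace (𝓡 (2 * n)) : M → Type) x₀).open_baseSet.mem_nhds
    (FiberBundle.mem_baseSet_trivializationAt' x₀), (trivializationAt (Model n →L[ℝ] ℝ)
    (fun x : M ↦ TangentSpace (𝓡 (2 * n)) x →L[ℝ] Bundle.Trivial M ℝ x) x₀).open_baseSet.mem_nhds
    (FiberBundle.mem_baseSet_trivializationAt' x₀)] with x hx h'x
  simp only [Function.comp_apply]
  rw [inCoordinates_eq hx h'x]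
  refine (inCoordinates_eq (x := id x) (y := id x) h'x hx).trans ?_
  simp only [inverse_equiv_comp, inverse_comp_equiv, ContinuousLinearEquiv.symm_symm]
  rfl

end Smooth

/-! ### Symmetries and traces of the curvature -/

section FieldCalculus

variable {n : ℕ} {M : Type u} [TopologicalSpace M] [ChartedSpace (Model n) M]
  [IsManifold (𝓡 (2 * n)) ∞ M] [T2Space M] {J : SymplecticForm n M} {cov : AffineConnection n M}

variable (n M) in
/-- Smooth vector fields. -/
abbrev SmoothField : Type u :=
  Cₛ^∞⟮𝓡 (2 * n); Model n, (TangentSpace (𝓡 (2 * n)) : M → Type)⟯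

theorem isSmoothForm_form (J : SymplecticForm n M) : IsSmoothForm J.form :=
  contMDiff_form_iff.1 J.smooth

theorem mlieBracket_eq (hcov : IsSymplecticConnection J cov)
    {X Y : Π x : M, TangentSpace (𝓡 (2 * n)) x} (hX : IsSmoothSection n (Model n) X)
    (hY : IsSmoothSection n (Model n) Y) (x : M) :
    VectorField.mlieBracket (𝓡 (2 * n)) X Y x = cov Y x (X x) - cov X x (Y x) :=
  (cov.torsion_eq_zero_iff.1 hcov.torsion_eq_zero ((hX x).mdifferentiableAt (by simp))
    ((hY x).mdifferentiableAt (by simp))).symm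

/-- The covariant derivative `∇_X Y` of smooth vector fields. -/
def fieldNab (hcov : IsSymplecticConnection J cov) :
    SmoothField n M →+ SmoothField n M →+ SmoothField n M :=
  AddMonoidHom.mk' (fun X ↦ AddMonoidHom.mk'
      (fun Y ↦ ⟨fun y ↦ cov Y y (X y), isSmoothSection_cov hcov.smooth X.contMDiff Y.contMDiff⟩)
      (fun Y Y' ↦ by
        ext y : 1
        exact congr($(cov_add cov Y.contMDiff Y'.contMDiff y) (X y))))
    (fun X X' ↦ by ext Y y : 2; exact map_add (cov Y y) (X y) (X' y))

theorem fieldNab_bracket (hcov : IsSymplecticConnection J cov) (X Y : SmoothField n M) :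
    VectorField.mlieBracket (𝓡 (2 * n)) X Y = ⇑(fieldNab hcov X Y - fieldNab hcov Y X) := by
  ext1 x
  exact mlieBracket_eq hcov X.contMDiff Y.contMDiff x

/-- The calculus of smooth functions and vector fields on a manifold with a symplectic
connection. -/
def fieldCalculus (hcov : IsSymplecticConnection J cov) :
    SymplecticCalculus C^∞⟮𝓡 (2 * n), M; ℝ⟯ (SmoothField n M) where
  d := AddMonoidHom.mk' (fun X ↦ AddMonoidHom.mk'
      (fun f ↦ ⟨fun y ↦ mvfderiv (𝓡 (2 * n)) f y (X y),
        contMDiff_mvfderiv_apply X.contMDiff f.contMDiff⟩)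
      (fun f g ↦ by
        ext y
        have := mvfderiv_add (I := 𝓡 (2 * n)) ((f.contMDiff y).mdifferentiableAt (by simp))
          ((g.contMDiff y).mdifferentiableAt (by simp))
        exact congr($this (X y))))
    (fun X Y ↦ by ext f y; exact map_add (mvfderiv (𝓡 (2 * n)) f y) (X y) (Y y))
  nab := fieldNab hcov
  J := AddMonoidHom.mk' (fun X ↦ AddMonoidHom.mk'
      (fun Y ↦ ⟨fun y ↦ J.form y (X y) (Y y), isSmoothForm_form J X X.contMDiff Y Y.contMDiff⟩)
      (fun Y Y' ↦ by ext y; exact map_add (J.form y (X y)) (Y y) (Y' y)))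
    (fun X X' ↦ by ext Y y; exact congr($(map_add (J.form y) (X y) (X' y)) (Y y)))
  d_mul X f g := by
    ext y
    have := congr($(mvfderiv_mul (I := 𝓡 (2 * n)) ((f.contMDiff y).mdifferentiableAt (by simp))
          ((g.contMDiff y).mdifferentiableAt (by simp))) (X y))
    refine this.trans ?_
    change f y * mvfderiv (𝓡 (2 * n)) g y (X y) + g y * mvfderiv (𝓡 (2 * n)) f y (X y) =
      mvfderiv (𝓡 (2 * n)) f y (X y) * g y + f y * mvfderiv (𝓡 (2 * n)) g y (X y)
    ring
  commutator X Y f := by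
    ext y
    have := commutator_mvfderiv X.contMDiff Y.contMDiff f.contMDiff y
    rw [fieldNab_bracket hcov] at this
    exact this
  jacobi X Y Z := by
    have le : minSmoothness ℝ 2 ≤ (∞ : WithTop ℕ∞) := by
      simpa using! (ENat.LEInfty.out : (2 : WithTop ℕ∞) ≤ ∞)
    have : IsManifold (𝓡 (2 * n)) (minSmoothness ℝ 3) M := by
      simpa using (inferInstance : IsManifold (𝓡 (2 * n)) 3 M)
    have h := VectorField.leibniz_identity_mlieBracket (X.contMDiff.of_le le) (Y.contMDiff.of_le le)
      (Z.contMDiff.of_le le) (I := 𝓡 (2 * n))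
    simp only [fieldNab_bracket hcov] at h
    have h' : fieldNab hcov X (fieldNab hcov Y Z - fieldNab hcov Z Y)
          - fieldNab hcov (fieldNab hcov Y Z - fieldNab hcov Z Y) X
        = (fieldNab hcov (fieldNab hcov X Y - fieldNab hcov Y X) Z
          - fieldNab hcov Z (fieldNab hcov X Y - fieldNab hcov Y X))
        + (fieldNab hcov Y (fieldNab hcov X Z - fieldNab hcov Z X)
          - fieldNab hcov (fieldNab hcov X Z - fieldNab hcov Z X) Y) := DFunLike.coe_injective h
    rw [← sub_eq_zero] at h'
    rw [← h']
    simp only [map_sub, AddMonoidHom.sub_apply]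
    abel
  skew X Y := by ext y; exact J.skew y (X y) (Y y)
  parallel X Y Z := by
    ext y
    exact hcov.parallel X Y Z X.contMDiff Y.contMDiff Z.contMDiff y

theorem coe_fieldCalculus_curv (hcov : IsSymplecticConnection J cov) (X Y Z : SmoothField n M) :
    ⇑((fieldCalculus hcov).curv X Y Z) = curvature cov X Y Z := by
  ext1 x
  unfold curvature
  rw [fieldNab_bracket hcov]
  rfl

theorem exists_smoothField (x : M) (v : TangentSpace (𝓡 (2 * n)) x) :
    ∃ X : SmoothField n M, X x = v := by
  obtain ⟨s, hs, h⟩ := exists_smooth_section (I := 𝓡 (2 * n)) (F := Model n) x v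
  exact ⟨⟨s, hs⟩, h⟩

theorem curvatureTensor_eq_curv (hcov : IsSymplecticConnection J cov) (X Y Z : SmoothField n M)
    (x : M) : curvatureTensor cov x (X x) (Y x) (Z x) = (fieldCalculus hcov).curv X Y Z x := by
  rw [curvatureTensor_apply hcov.smooth X.contMDiff Y.contMDiff Z.contMDiff, coe_fieldCalculus_curv]

theorem curvatureTensor_swap (hcov : IsSymplecticConnection J cov) (x : M)
    (u v w : TangentSpace (𝓡 (2 * n)) x) :
    curvatureTensor cov x u v w = - curvatureTensor cov x v u w := by
  obtain ⟨X, rfl⟩ := exists_smoothField x u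
  obtain ⟨Y, rfl⟩ := exists_smoothField x v
  obtain ⟨Z, rfl⟩ := exists_smoothField x w
  rw [curvatureTensor_apply hcov.smooth X.contMDiff Y.contMDiff Z.contMDiff,
    curvatureTensor_apply hcov.smooth Y.contMDiff X.contMDiff Z.contMDiff, curvature_swap]

theorem curvatureTensor_bianchi (hcov : IsSymplecticConnection J cov) (x : M)
    (u v w : TangentSpace (𝓡 (2 * n)) x) :
    curvatureTensor cov x u v w + curvatureTensor cov x v w u
      + curvatureTensor cov x w u v = 0 := by
  obtain ⟨X, rfl⟩ := exists_smoothField x u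
  obtain ⟨Y, rfl⟩ := exists_smoothField x v
  obtain ⟨Z, rfl⟩ := exists_smoothField x w
  simp only [curvatureTensor_eq_curv hcov]
  exact congr($((fieldCalculus hcov).first_bianchi X Y Z) x)

theorem form_curvatureTensor_comm (hcov : IsSymplecticConnection J cov) (x : M)
    (u v w t : TangentSpace (𝓡 (2 * n)) x) :
    J.form x (curvatureTensor cov x u v w) t = J.form x (curvatureTensor cov x u v t) w := by
  obtain ⟨X, rfl⟩ := exists_smoothField x u
  obtain ⟨Y, rfl⟩ := exists_smoothField x v
  obtain ⟨Z, rfl⟩ := exists_smoothField x w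
  obtain ⟨T, rfl⟩ := exists_smoothField x t
  simp only [curvatureTensor_eq_curv hcov]
  exact congr($((fieldCalculus hcov).curv_symplectic X Y Z T) x)

end FieldCalculus

section Trace

variable {n : ℕ} {M : Type u} [TopologicalSpace M] [ChartedSpace (Model n) M]
  [IsManifold (𝓡 (2 * n)) ∞ M] {J : SymplecticForm n M} {cov : AffineConnection n M}

/-- The vectors `J^♯ θ^j` for the dual basis `θ^j` of the coordinate basis. -/
def dualVector (J : SymplecticForm n M) (x : M) (j : Fin (2 * n)) : TangentSpace (𝓡 (2 * n)) x :=
  J.sharp x (LinearMap.toContinuousLinearMap ((coordBasis x).coord j))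

/-- The symplectic form as a bilinear map. -/
def formLin (J : SymplecticForm n M) (x : M) :
    TangentSpace (𝓡 (2 * n)) x →ₗ[ℝ] TangentSpace (𝓡 (2 * n)) x →ₗ[ℝ] ℝ :=
  (J.form x).toLinearMap₁₂

theorem formLin_apply (J : SymplecticForm n M) (x : M) (u v : TangentSpace (𝓡 (2 * n)) x) :
    formLin J x u v = J.form x u v := rfl

theorem formLin_dualVector (J : SymplecticForm n M) (x : M) (j : Fin (2 * n))
    (v : TangentSpace (𝓡 (2 * n)) x) :
    formLin J x (dualVector J x j) v = (coordBasis x).coord j v := by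
  rw [formLin_apply, dualVector, J.form_sharp]
  rfl

theorem coord_eq_form (J : SymplecticForm n M) (x : M) (j : Fin (2 * n))
    (v : TangentSpace (𝓡 (2 * n)) x) :
    (coordBasis x).coord j v = - J.form x v (dualVector J x j) := by
  rw [← formLin_dualVector J, formLin_apply, J.skew]

variable [T2Space M]

theorem ricci_apply (x : M) (v w : TangentSpace (𝓡 (2 * n)) x) :
    ricci cov x v w = ∑ i, (coordBasis x).coord i (curvatureTensor cov x (coordBasis x i) v w) := by
  simp [ricci]

theorem phi_apply (x : M) (v w : TangentSpace (𝓡 (2 * n)) x) :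
    phi cov x v w = 1 / (2 * ((n : ℝ) + 1)) * ricci cov x v w := rfl

theorem ricci_symm (hcov : IsSymplecticConnection J cov) (x : M)
    (v w : TangentSpace (𝓡 (2 * n)) x) : ricci cov x v w = ricci cov x w v := by
  -- the trace of `R_ab` vanishes because `J(R_ab ·, ·)` is symmetric
  have h0 := sum_symm_dual_basis (formLin_dualVector J x) (J.skew x)
    ((formLin J x).comp (curvatureTensor cov x v w))
    (fun a b ↦ form_curvatureTensor_comm hcov x v w a b)
  rw [← sub_eq_zero, ricci_apply, ricci_apply, ← Finset.sum_sub_distrib, ← h0]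
  refine Finset.sum_congr rfl fun i _ ↦ ?_
  have h := curvatureTensor_bianchi hcov x (coordBasis x i) v w
  rw [← map_sub, coord_eq_form J]
  have : curvatureTensor cov x (coordBasis x i) v w - curvatureTensor cov x (coordBasis x i) w v =
      - curvatureTensor cov x v w (coordBasis x i) := by
    rw [curvatureTensor_swap hcov x _ w v, ← sub_eq_zero, ← h]
    abel
  rw [this]
  simp [formLin_apply]

theorem phi_symm (hcov : IsSymplecticConnection J cov) (x : M)
    (v w : TangentSpace (𝓡 (2 * n)) x) : phi cov x v w = phi cov x w v := by
  rw [phi_apply, phi_apply, ricci_symm hcov]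

/-- A curvature built from a symmetric `Φ` has Ricci trace `2 (n + 1) Φ`. -/
theorem trace_phiCurvature
    {Φ : Π x : M, TangentSpace (𝓡 (2 * n)) x →L[ℝ] TangentSpace (𝓡 (2 * n)) x →L[ℝ] ℝ}
    (x : M) (hΦ : ∀ v w, Φ x v w = Φ x w v) (v w : TangentSpace (𝓡 (2 * n)) x) :
    ∑ i, (coordBasis x).coord i (phiCurvature J Φ x (coordBasis x i) v w) =
      2 * ((n : ℝ) + 1) * Φ x v w := by
  have hc := formLin_dualVector J x
  have h0 : ∑ i, Φ x (coordBasis x i) (dualVector J x i) = 0 :=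
    sum_symm_dual_basis hc (J.skew x) ((Φ x).toLinearMap₁₂) hΦ
  have h1 (f : TangentSpace (𝓡 (2 * n)) x →ₗ[ℝ] ℝ) (u : TangentSpace (𝓡 (2 * n)) x) :
      ∑ i, f (coordBasis x i) * (coordBasis x).coord i u = f u := by
    simp only [← formLin_dualVector J]
    exact sum_basis_mul_form hc f u
  have e1 : ∑ i, Φ x (coordBasis x i) w * (coordBasis x).coord i v = Φ x v w :=
    h1 ((Φ x).toLinearMap₁₂.flip w) v
  have e2 := h1 ((formLin J x).flip w) (J.sharp x (Φ x v))
  have e3 := h1 ((formLin J x).flip v) (J.sharp x (Φ x w))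
  have e4 (i : Fin (2 * n)) : (coordBasis x).coord i (J.sharp x (Φ x (coordBasis x i))) =
      - Φ x (coordBasis x i) (dualVector J x i) := by
    rw [coord_eq_form J, J.form_sharp]
  have e5 (i : Fin (2 * n)) : (coordBasis x).coord i (coordBasis x i) = 1 := by simp
  simp only [LinearMap.flip_apply, formLin_apply] at e2 e3
  simp only [phiCurvature, map_add, map_sub, map_smul, smul_eq_mul, Finset.sum_add_distrib,
    Finset.sum_sub_distrib, mul_assoc, ← Finset.mul_sum, e1, e2, e3, e4, e5, h0, J.form_sharp,
    Finset.sum_neg_distrib, Finset.sum_const, Finset.card_univ, Fintype.card_fin]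
  rw [hΦ w v]
  simp
  ring

theorem trace_vTensor (hcov : IsSymplecticConnection J cov) (x : M)
    (v w : TangentSpace (𝓡 (2 * n)) x) :
    ∑ i, (coordBasis x).coord i (vTensor J cov x (coordBasis x i) v w) = 0 := by
  simp only [vTensor, map_sub, Finset.sum_sub_distrib]
  rw [trace_phiCurvature x (phi_symm hcov x), ← ricci_apply, phi_apply]
  field_simp
  simp

end Trace

/-! ### The tractor connection -/

section TensorSmooth

variable {n : ℕ} {M : Type u} [TopologicalSpace M] [ChartedSpace (Model n) M]
  [IsManifold (𝓡 (2 * n)) ∞ M] [T2Space M] {J : SymplecticForm n M} {cov : AffineConnection n M}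
  {X Y Z : Π x : M, TangentSpace (𝓡 (2 * n)) x}

theorem isSmoothSection_curvatureTensor
    (hcov : CovariantDerivative.ContMDiffCovariantDerivative cov ∞)
    (hX : IsSmoothSection n (Model n) X) (hY : IsSmoothSection n (Model n) Y)
    (hZ : IsSmoothSection n (Model n) Z) :
    IsSmoothSection n (Model n) fun x ↦ curvatureTensor cov x (X x) (Y x) (Z x) := by
  simp only [curvatureTensor_apply hcov hX hY hZ]
  exact isSmoothSection_curvature hcov hX hY hZ

theorem isSmoothForm_phi (hcov : CovariantDerivative.ContMDiffCovariantDerivative cov ∞) :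
    IsSmoothForm (phi cov) := by
  intro Y hY Z hZ
  have h := contMDiff_contraction (n := n) (M := M)
    (fun x ↦ LinearMap.mk₂ ℝ (fun v α ↦ α (curvatureTensor cov x v (Y x) (Z x)))
      (by simp) (by simp) (by simp) (by simp))
    (fun X μ hX hμ ↦ hμ _ (isSmoothSection_curvatureTensor hcov hX hY hZ))
  simp only [phi_apply, ricci_apply]
  exact contMDiff_const.mul h

theorem contMDiff_covDerivForm
    {Φ : Π x : M, TangentSpace (𝓡 (2 * n)) x →L[ℝ] TangentSpace (𝓡 (2 * n)) x →L[ℝ] ℝ}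
    (hΦ : IsSmoothForm Φ) (hcov : CovariantDerivative.ContMDiffCovariantDerivative cov ∞)
    (hX : IsSmoothSection n (Model n) X) (hY : IsSmoothSection n (Model n) Y)
    (hZ : IsSmoothSection n (Model n) Z) :
    ContMDiff (𝓡 (2 * n)) 𝓘(ℝ) ∞ fun x ↦ covDerivForm cov Φ x (X x) (Y x) (Z x) := by
  simp only [covDerivForm_apply hΦ cov hX hY]
  exact ((contMDiff_mvfderiv_apply hZ (hΦ X hX Y hY)).sub
    (hΦ _ (isSmoothSection_cov hcov hZ hX) _ hY)).sub
    (hΦ _ hX _ (isSmoothSection_cov hcov hZ hY))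

theorem sForm_apply (x : M) (v : TangentSpace (𝓡 (2 * n)) x) :
    sForm J cov x v = (1 / (2 * (n : ℝ) + 1)) *
      ∑ j, covDerivForm cov (phi cov) x v (dualVector J x j) (coordBasis x j) := by
  simp only [sForm, LinearMap.coe_toContinuousLinearMap']
  have : ((coordBasis x).constr ℝ fun i ↦
    (1 / (2 * (n : ℝ) + 1)) * ∑ j, covDerivForm cov (phi cov) x (coordBasis x i)
      (J.sharp x (LinearMap.toContinuousLinearMap ((coordBasis x).coord j))) (coordBasis x j)) =
    (1 / (2 * (n : ℝ) + 1)) • ∑ j, ((covDerivForm cov (phi cov) x).flip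
      (dualVector J x j)).flip (coordBasis x j) :=
    (coordBasis x).ext fun i ↦ by simp [dualVector]
  rw [this]
  simp

/-- The sharp of a linear form, linearly in the form. -/
def sharpLin (J : SymplecticForm n M) (x : M) :
    (TangentSpace (𝓡 (2 * n)) x →ₗ[ℝ] ℝ) →ₗ[ℝ] TangentSpace (𝓡 (2 * n)) x :=
  (J.sharp x).toLinearMap ∘ₗ LinearMap.toContinuousLinearMap.toLinearMap

/-- The contraction `J^bc B_bc` of a smooth family of bilinear forms is smooth. -/
theorem contMDiff_sum_dualVector (J : SymplecticForm n M)
    (B : Π x : M, TangentSpace (𝓡 (2 * n)) x →ₗ[ℝ] TangentSpace (𝓡 (2 * n)) x →ₗ[ℝ] ℝ)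
    (hB : ∀ Y Z : Π x : M, TangentSpace (𝓡 (2 * n)) x, IsSmoothSection n (Model n) Y →
      IsSmoothSection n (Model n) Z → ContMDiff (𝓡 (2 * n)) 𝓘(ℝ) ∞ fun x ↦ B x (Y x) (Z x)) :
    ContMDiff (𝓡 (2 * n)) 𝓘(ℝ) ∞ fun x ↦ ∑ j, B x (dualVector J x j) (coordBasis x j) :=
  contMDiff_contraction (fun x ↦ ((B x).comp (sharpLin J x)).flip)
    fun Y _ hY hμ ↦ hB _ Y (isSmoothSection_sharp J hμ) hY

theorem isSmoothCovector_sForm (J : SymplecticForm n M)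
    (hcov : CovariantDerivative.ContMDiffCovariantDerivative cov ∞) :
    IsSmoothCovector (sForm J cov) := by
  intro X hX
  simp only [sForm_apply]
  exact contMDiff_const.mul (contMDiff_sum_dualVector J
    (fun x ↦ covDerivForm cov (phi cov) x (X x)) fun Y Z hY hZ ↦
      contMDiff_covDerivForm (isSmoothForm_phi hcov) hcov hX hY hZ)

theorem isSmoothForm_covDerivCovector {μ : Π x : M, TangentSpace (𝓡 (2 * n)) x →L[ℝ] ℝ}
    (hμ : IsSmoothCovector μ) (hcov : CovariantDerivative.ContMDiffCovariantDerivative cov ∞) :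
    IsSmoothForm (covDerivCovector cov μ) := by
  intro X hX Y hY
  simp only [covDerivCovector_apply hμ cov hY]
  exact (contMDiff_mvfderiv_apply hX (hμ Y hY)).sub (hμ _ (isSmoothSection_cov hcov hX hY))

end TensorSmooth

section TractorConnection

variable {n : ℕ} {M : Type u} [TopologicalSpace M] [ChartedSpace (Model n) M]
  [IsManifold (𝓡 (2 * n)) ∞ M] {J : SymplecticForm n M} {cov : AffineConnection n M}

variable {μ ν : Π x : M, TangentSpace (𝓡 (2 * n)) x →L[ℝ] ℝ} {x : M}

/-- Differentiability at a point of a family of covectors. -/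
def MDiffCovectorAt (μ : Π x : M, TangentSpace (𝓡 (2 * n)) x →L[ℝ] ℝ) (x : M) : Prop :=
  MDifferentiableAt (𝓡 (2 * n)) ((𝓡 (2 * n)).prod 𝓘(ℝ, Model n →L[ℝ] ℝ))
    (fun x ↦ TotalSpace.mk' (Model n →L[ℝ] ℝ)
      (E := fun x : M ↦ TangentSpace (𝓡 (2 * n)) x →L[ℝ] Bundle.Trivial M ℝ x) x (μ x)) x

theorem MDiffCovectorAt.apply_coordField (hμ : MDiffCovectorAt μ x) (j : Fin (2 * n)) :
    MDifferentiableAt (𝓡 (2 * n)) 𝓘(ℝ) (fun y ↦ μ y (coordField x j y)) x :=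
  mdifferentiableAt_trivial_section_iff.1
    (MDifferentiableAt.clm_bundle_apply (F₂ := ℝ) (E₂ := Bundle.Trivial M ℝ) hμ
      (mdifferentiableAt_coordField x j))

theorem covDerivCovector_coordBasis (w : TangentSpace (𝓡 (2 * n)) x) (j : Fin (2 * n)) :
    covDerivCovector cov μ x w (coordBasis x j) =
      mvfderiv (𝓡 (2 * n)) (fun y ↦ μ y (coordField x j y)) x w
        - μ x (cov (coordField x j) x w) := by
  simp [covDerivCovector]

theorem covDerivCovector_add (hμ : MDiffCovectorAt μ x) (hν : MDiffCovectorAt ν x) :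
    covDerivCovector cov (fun y ↦ μ y + ν y) x =
      covDerivCovector cov μ x + covDerivCovector cov ν x := by
  ext w v
  revert v
  refine LinearMap.congr_fun (f := (covDerivCovector cov (fun y ↦ μ y + ν y) x w).toLinearMap)
    (g := (covDerivCovector cov μ x w + covDerivCovector cov ν x w).toLinearMap) ?_
  refine (coordBasis x).ext fun j ↦ ?_
  have h := congr($(mvfderiv_add (hμ.apply_coordField j) (hν.apply_coordField j)) w)
  change covDerivCovector cov (fun y ↦ μ y + ν y) x w (coordBasis x j) =
    covDerivCovector cov μ x w (coordBasis x j) + covDerivCovector cov ν x w (coordBasis x j)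
  rw [covDerivCovector_coordBasis, covDerivCovector_coordBasis, covDerivCovector_coordBasis]
  have h' : mvfderiv (𝓡 (2 * n)) (fun y ↦ (μ y + ν y) (coordField x j y)) x w =
    mvfderiv (𝓡 (2 * n)) (fun y ↦ μ y (coordField x j y)) x w +
    mvfderiv (𝓡 (2 * n)) (fun y ↦ ν y (coordField x j y)) x w := h
  rw [h', add_apply]
  ring

theorem covDerivCovector_smul {f : M → ℝ} (hf : MDifferentiableAt (𝓡 (2 * n)) 𝓘(ℝ) f x)
    (hμ : MDiffCovectorAt μ x) (w v : TangentSpace (𝓡 (2 * n)) x) :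
    covDerivCovector cov (fun y ↦ f y • μ y) x w v =
      f x * covDerivCovector cov μ x w v + mvfderiv (𝓡 (2 * n)) f x w * μ x v := by
  revert v
  refine LinearMap.congr_fun (f := (covDerivCovector cov (fun y ↦ f y • μ y) x w).toLinearMap)
    (g := (f x • covDerivCovector cov μ x w + mvfderiv (𝓡 (2 * n)) f x w • μ x).toLinearMap) ?_
  refine (coordBasis x).ext fun j ↦ ?_
  have h := congr($(mvfderiv_mul hf (hμ.apply_coordField j)) w)
  change covDerivCovector cov (fun y ↦ f y • μ y) x w (coordBasis x j) =
    f x * covDerivCovector cov μ x w (coordBasis x j)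
      + mvfderiv (𝓡 (2 * n)) f x w * μ x (coordBasis x j)
  rw [covDerivCovector_coordBasis, covDerivCovector_coordBasis]
  have h' : mvfderiv (𝓡 (2 * n)) (fun y ↦ (f y • μ y) (coordField x j y)) x w =
    f x * mvfderiv (𝓡 (2 * n)) (fun y ↦ μ y (coordField x j y)) x w +
    μ x (coordField x j x) * mvfderiv (𝓡 (2 * n)) f x w := h
  rw [h', smul_apply, coordField_self, smul_eq_mul]
  ring

theorem tractorDerivative_apply (s : Π x : M, Tractor n M x) (u : TangentSpace (𝓡 (2 * n)) x) :
    tractorDerivative J cov s x u =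
      (mvfderiv (𝓡 (2 * n)) (fun y ↦ (s y).1) x u - (s x).2.1 u,
        (covDerivCovector cov (fun y ↦ (s y).2.1) x u + (s x).2.2 • J.form x u
            + (s x).1 • phi cov x u : TangentSpace (𝓡 (2 * n)) x →L[ℝ] ℝ),
        mvfderiv (𝓡 (2 * n)) (fun y ↦ (s y).2.2) x u - phi cov x u (J.sharp x ((s x).2.1))
          + (s x).1 * sForm J cov x u) := rfl

theorem mdifferentiableAt_tractor_iff {s : Π x : M, Tractor n M x} :
    MDifferentiableAt (𝓡 (2 * n)) ((𝓡 (2 * n)).prod 𝓘(ℝ, TractorModel n))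
      (fun x ↦ TotalSpace.mk' (TractorModel n) x (s x)) x ↔
    MDifferentiableAt (𝓡 (2 * n)) 𝓘(ℝ) (fun y ↦ (s y).1) x ∧
      MDiffCovectorAt (fun y ↦ (s y).2.1) x ∧
      MDifferentiableAt (𝓡 (2 * n)) 𝓘(ℝ) (fun y ↦ (s y).2.2) x := by
  rw [← mdifferentiableAt_trivial_section_iff,
    ← mdifferentiableAt_trivial_section_iff (f := fun y ↦ (s y).2.2)]
  exact mdifferentiableAt_prod_section_iff.trans
    (and_congr_right' mdifferentiableAt_prod_section_iff)

/-- The tractor connection as a connection on the tractor bundle. -/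
def tractorConnection (J : SymplecticForm n M) (cov : AffineConnection n M) :
    CovariantDerivative (𝓡 (2 * n)) (TractorModel n) (Tractor n M) where
  toFun := tractorDerivative J cov
  isCovariantDerivativeOnUniv :=
    { add := fun {s t x} hs ht _ ↦ by
        obtain ⟨h1, h2, h3⟩ := mdifferentiableAt_tractor_iff.1 hs
        obtain ⟨k1, k2, k3⟩ := mdifferentiableAt_tractor_iff.1 ht
        have e1 := mvfderiv_add h1 k1
        have e2 := covDerivCovector_add (cov := cov) h2 k2
        have e3 := mvfderiv_add h3 k3
        refine ContinuousLinearMap.ext fun u ↦ Prod.ext ?_ (Prod.ext ?_ ?_)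
        · change mvfderiv (𝓡 (2 * n)) ((fun y ↦ (s y).1) + fun y ↦ (t y).1) x u
              - ((s x).2.1 u + (t x).2.1 u)
            = (mvfderiv (𝓡 (2 * n)) (fun y ↦ (s y).1) x u - (s x).2.1 u)
              + (mvfderiv (𝓡 (2 * n)) (fun y ↦ (t y).1) x u - (t x).2.1 u)
          rw [e1, add_apply]
          ring
        · refine ContinuousLinearMap.ext fun v ↦ ?_
          change covDerivCovector cov (fun y ↦ (s y).2.1 + (t y).2.1) x u v
              + ((s x).2.2 + (t x).2.2) * J.form x u v + ((s x).1 + (t x).1) * phi cov x u v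
            = (covDerivCovector cov (fun y ↦ (s y).2.1) x u v
              + (s x).2.2 * J.form x u v + (s x).1 * phi cov x u v)
            + (covDerivCovector cov (fun y ↦ (t y).2.1) x u v
              + (t x).2.2 * J.form x u v + (t x).1 * phi cov x u v)
          rw [e2, add_apply, add_apply]
          ring
        · change mvfderiv (𝓡 (2 * n)) ((fun y ↦ (s y).2.2) + fun y ↦ (t y).2.2) x u
              - phi cov x u (J.sharp x ((s x).2.1 + (t x).2.1))
              + ((s x).1 + (t x).1) * sForm J cov x u
            = (mvfderiv (𝓡 (2 * n)) (fun y ↦ (s y).2.2) x u - phi cov x u (J.sharp x ((s x).2.1))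
              + (s x).1 * sForm J cov x u)
            + (mvfderiv (𝓡 (2 * n)) (fun y ↦ (t y).2.2) x u - phi cov x u (J.sharp x ((t x).2.1))
              + (t x).1 * sForm J cov x u)
          rw [e3, add_apply, map_add, map_add]
          ring
      leibniz := fun {s f x} hs hf _ ↦ by
        obtain ⟨h1, h2, h3⟩ := mdifferentiableAt_tractor_iff.1 hs
        have e1 := mvfderiv_mul hf h1
        have e2 := covDerivCovector_smul (cov := cov) hf h2
        have e3 := mvfderiv_mul hf h3
        refine ContinuousLinearMap.ext fun u ↦ Prod.ext ?_ (Prod.ext ?_ ?_)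
        · change mvfderiv (𝓡 (2 * n)) (f * fun y ↦ (s y).1) x u - f x * (s x).2.1 u
            = f x * (mvfderiv (𝓡 (2 * n)) (fun y ↦ (s y).1) x u - (s x).2.1 u)
              + mvfderiv (𝓡 (2 * n)) f x u * (s x).1
          rw [e1, add_apply, smul_apply, smul_apply, smul_eq_mul, smul_eq_mul]
          ring
        · refine ContinuousLinearMap.ext fun v ↦ ?_
          change covDerivCovector cov (fun y ↦ f y • (s y).2.1) x u v
              + (f x * (s x).2.2) * J.form x u v + (f x * (s x).1) * phi cov x u v
            = f x * (covDerivCovector cov (fun y ↦ (s y).2.1) x u v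
              + (s x).2.2 * J.form x u v + (s x).1 * phi cov x u v)
              + mvfderiv (𝓡 (2 * n)) f x u * (s x).2.1 v
          rw [e2]
          ring
        · change mvfderiv (𝓡 (2 * n)) (f * fun y ↦ (s y).2.2) x u
              - phi cov x u (J.sharp x (f x • (s x).2.1)) + (f x * (s x).1) * sForm J cov x u
            = f x * (mvfderiv (𝓡 (2 * n)) (fun y ↦ (s y).2.2) x u
              - phi cov x u (J.sharp x ((s x).2.1)) + (s x).1 * sForm J cov x u)
              + mvfderiv (𝓡 (2 * n)) f x u * (s x).2.2
          rw [e3, map_smul, map_smul, add_apply, smul_apply, smul_apply]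
          simp only [smul_eq_mul]
          ring }

variable [T2Space M]

theorem contMDiff_tractorDerivative
    (hcov : CovariantDerivative.ContMDiffCovariantDerivative cov ∞) {s : Π x : M, Tractor n M x}
    (hs : IsSmoothSection n (TractorModel n) s) {X : Π x : M, TangentSpace (𝓡 (2 * n)) x}
    (hX : IsSmoothSection n (Model n) X) :
    IsSmoothSection n (TractorModel n) fun x ↦ tractorDerivative J cov s x (X x) := by
  obtain ⟨h1, h2, h3⟩ := isSmoothSection_tractor_iff.1 hs
  have hΦ := isSmoothForm_phi hcov
  refine isSmoothSection_tractor_iff.2 ⟨?_, fun Y hY ↦ ?_, ?_⟩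
  · exact (contMDiff_mvfderiv_apply hX h1).sub (h2 X hX)
  · exact ((isSmoothForm_covDerivCovector h2 hcov X hX Y hY).add
      (h3.mul (isSmoothForm_form J X hX Y hY))).add (h1.mul (hΦ X hX Y hY))
  · exact ((contMDiff_mvfderiv_apply hX h3).sub (hΦ X hX _ (isSmoothSection_sharp J h2))).add
      (h1.mul (isSmoothCovector_sForm J hcov X hX))

theorem contMDiff_tractorConnection (J : SymplecticForm n M)
    (hcov : CovariantDerivative.ContMDiffCovariantDerivative cov ∞) :
    CovariantDerivative.ContMDiffCovariantDerivative (tractorConnection J cov) ∞ where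
  contMDiff :=
    { contMDiff := fun {s} hs ↦ by
        have hs' : IsSmoothSection n (TractorModel n) s := by simpa using! contMDiffOn_univ.1 hs
        refine contMDiffOn_univ.2 (contMDiff_hom_of_apply
          (V := (TangentSpace (𝓡 (2 * n)) : M → Type)) (W := Tractor n M) (F' := TractorModel n)
          (tractorDerivative J cov s) fun X hX ↦ contMDiff_tractorDerivative hcov hs' hX) }

end TractorConnection

/-! ### Naturality -/

section Naturality

variable {n : ℕ} {M : Type u} [TopologicalSpace M] [ChartedSpace (Model n) M]
  [IsManifold (𝓡 (2 * n)) ∞ M] [T2Space M] {J : SymplecticForm n M} {cov : AffineConnection n M}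
  {M' : Type u} [TopologicalSpace M'] [ChartedSpace (Model n) M']
  [IsManifold (𝓡 (2 * n)) ∞ M'] [T2Space M'] {J' : SymplecticForm n M'}
  {cov' : AffineConnection n M'} {f : M → M'}

/-- The differential of a local isomorphism. -/
def IsLocalIsomorphism.df (h : IsLocalIsomorphism J cov J' cov' f) (x : M) :
    TangentSpace (𝓡 (2 * n)) x ≃L[ℝ] TangentSpace (𝓡 (2 * n)) (f x) :=
  h.isLocalDiffeomorph.mfderivToContinuousLinearEquiv (by simp) x

theorem IsLocalIsomorphism.coe_df (h : IsLocalIsomorphism J cov J' cov' f) (x : M) :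
    (h.df x : TangentSpace (𝓡 (2 * n)) x →L[ℝ] TangentSpace (𝓡 (2 * n)) (f x)) =
      mfderiv (𝓡 (2 * n)) (𝓡 (2 * n)) f x :=
  h.isLocalDiffeomorph.mfderivToContinuousLinearEquiv_coe (by simp) x

theorem IsLocalIsomorphism.df_apply (h : IsLocalIsomorphism J cov J' cov' f) (x : M)
    (u : TangentSpace (𝓡 (2 * n)) x) :
    h.df x u = mfderiv (𝓡 (2 * n)) (𝓡 (2 * n)) f x u := by
  rw [← h.coe_df]; rfl

theorem IsLocalIsomorphism.contMDiff (h : IsLocalIsomorphism J cov J' cov' f) :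
    ContMDiff (𝓡 (2 * n)) (𝓡 (2 * n)) ∞ f :=
  h.isLocalDiffeomorph.contMDiff

theorem IsLocalIsomorphism.form_df (h : IsLocalIsomorphism J cov J' cov' f) (x : M)
    (u v : TangentSpace (𝓡 (2 * n)) x) : J'.form (f x) (h.df x u) (h.df x v) = J.form x u v := by
  rw [h.df_apply, h.df_apply, h.form_eq]

/-- Vector fields related by a local isomorphism. -/
def IsLocalIsomorphism.Related (h : IsLocalIsomorphism J cov J' cov' f)
    (Y : Π x : M, TangentSpace (𝓡 (2 * n)) x) (Y' : Π x : M', TangentSpace (𝓡 (2 * n)) x) : Prop :=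
  IsSmoothSection n (Model n) Y ∧ IsSmoothSection n (Model n) Y' ∧ ∀ x, Y' (f x) = h.df x (Y x)

/-- Smooth fields are lifted from `M'`, where every tangent vector extends to a global field. -/
theorem IsLocalIsomorphism.exists_related (h : IsLocalIsomorphism J cov J' cov' f) (x : M)
    (u : TangentSpace (𝓡 (2 * n)) x) : ∃ Y Y', h.Related Y Y' ∧ Y x = u := by
  obtain ⟨Y', hY', hx⟩ := exists_smooth_section (I := 𝓡 (2 * n)) (F := Model n) (f x) (h.df x u)
  have e (y : M) : h.df y (VectorField.mpullback (𝓡 (2 * n)) (𝓡 (2 * n)) f Y' y) = Y' (f y) := by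
    rw [VectorField.mpullback_apply, ← h.coe_df, ContinuousLinearMap.inverse_equiv]
    exact (h.df y).apply_symm_apply _
  have : IsManifold (𝓡 (2 * n)) (((⊤ : ℕ∞) : WithTop ℕ∞) + 1) M := ‹IsManifold (𝓡 (2 * n)) ∞ M›
  have : IsManifold (𝓡 (2 * n)) (((⊤ : ℕ∞) : WithTop ℕ∞) + 1) M' :=
    ‹IsManifold (𝓡 (2 * n)) ∞ M'›
  refine ⟨VectorField.mpullback (𝓡 (2 * n)) (𝓡 (2 * n)) f Y', Y', ⟨?_, hY', fun y ↦ (e y).symm⟩,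
    (h.df x).injective ?_⟩
  · exact ContMDiff.mpullback_vectorField (m := ∞) (n := ∞) hY' h.contMDiff
      (fun y ↦ ⟨h.df y, h.coe_df y⟩) (by simp)
  · rw [e, hx]

variable {X Y Z : Π x : M, TangentSpace (𝓡 (2 * n)) x}
  {X' Y' Z' : Π x : M', TangentSpace (𝓡 (2 * n)) x}

theorem IsLocalIsomorphism.cov_df (h : IsLocalIsomorphism J cov J' cov' f)
    (hX : h.Related X X') (hY : h.Related Y Y') (x : M) :
    cov' Y' (f x) (X' (f x)) = h.df x (cov Y x (X x)) := by
  rw [hX.2.2, h.df_apply, h.df_apply]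
  exact h.connection_eq Y Y' hY.1 hY.2.1 (fun x ↦ by rw [hY.2.2, h.df_apply]) x (X x)

theorem IsLocalIsomorphism.related_cov (h : IsLocalIsomorphism J cov J' cov' f)
    (hcov : CovariantDerivative.ContMDiffCovariantDerivative cov ∞)
    (hcov' : CovariantDerivative.ContMDiffCovariantDerivative cov' ∞)
    (hX : h.Related X X') (hY : h.Related Y Y') :
    h.Related (fun y ↦ cov Y y (X y)) (fun y ↦ cov' Y' y (X' y)) := by
  exact ⟨isSmoothSection_cov hcov hX.1 hY.1, isSmoothSection_cov hcov' hX.2.1 hY.2.1,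
    h.cov_df hX hY⟩

theorem IsLocalIsomorphism.mvfderiv_comp (h : IsLocalIsomorphism J cov J' cov' f) {g : M' → ℝ}
    (hg : ContMDiff (𝓡 (2 * n)) 𝓘(ℝ) ∞ g) (x : M) (u : TangentSpace (𝓡 (2 * n)) x) :
    mvfderiv (𝓡 (2 * n)) (fun y ↦ g (f y)) x u = mvfderiv (𝓡 (2 * n)) g (f x) (h.df x u) := by
  rw [h.df_apply]
  exact mvfderiv_comp_apply x ((hg (f x)).mdifferentiableAt (by simp))
    ((h.contMDiff x).mdifferentiableAt (by simp)) u

theorem IsLocalIsomorphism.curvatureTensor_df (h : IsLocalIsomorphism J cov J' cov' f)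
    (hcov : IsSymplecticConnection J cov) (hcov' : IsSymplecticConnection J' cov') (x : M)
    (u v w : TangentSpace (𝓡 (2 * n)) x) :
    curvatureTensor cov' (f x) (h.df x u) (h.df x v) (h.df x w) =
      h.df x (curvatureTensor cov x u v w) := by
  obtain ⟨X, X', hX, rfl⟩ := h.exists_related x u
  obtain ⟨Y, Y', hY, rfl⟩ := h.exists_related x v
  obtain ⟨Z, Z', hZ, rfl⟩ := h.exists_related x w
  rw [← hX.2.2, ← hY.2.2, ← hZ.2.2, curvatureTensor_apply hcov.smooth hX.1 hY.1 hZ.1,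
    curvatureTensor_apply hcov'.smooth hX.2.1 hY.2.1 hZ.2.1]
  unfold curvature
  rw [mlieBracket_eq hcov hX.1 hY.1, mlieBracket_eq hcov' hX.2.1 hY.2.1]
  have r {X X' Y Y'} (hX : h.Related X X') (hY : h.Related Y Y') :=
    (h.related_cov hcov.smooth hcov'.smooth hX hY)
  simp only [map_sub]
  rw [← h.cov_df hX (r hY hZ), ← h.cov_df hY (r hX hZ), ← h.cov_df (r hX hY) hZ,
    ← h.cov_df (r hY hX) hZ]

theorem IsLocalIsomorphism.ricci_df (h : IsLocalIsomorphism J cov J' cov' f)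
    (hcov : IsSymplecticConnection J cov) (hcov' : IsSymplecticConnection J' cov') (x : M)
    (v w : TangentSpace (𝓡 (2 * n)) x) :
    ricci cov' (f x) (h.df x v) (h.df x w) = ricci cov x v w := by
  rw [ricci_apply, ricci_apply]
  refine (sum_apply_coord_eq (coordBasis x) (coordBasis (f x)) (h.df x).toLinearEquiv
    (LinearMap.mk₂ ℝ (fun u α ↦ α (curvatureTensor cov x u v w))
      (by simp) (by simp) (by simp) (by simp))
    (fun u α ↦ α (curvatureTensor cov' (f x) u (h.df x v) (h.df x w))) fun u α ↦ ?_).symm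
  change α (h.df x _) = α (curvatureTensor cov' (f x) (h.df x u) (h.df x v) (h.df x w))
  rw [h.curvatureTensor_df hcov hcov']

theorem IsLocalIsomorphism.phi_df (h : IsLocalIsomorphism J cov J' cov' f)
    (hcov : IsSymplecticConnection J cov) (hcov' : IsSymplecticConnection J' cov') (x : M)
    (v w : TangentSpace (𝓡 (2 * n)) x) :
    phi cov' (f x) (h.df x v) (h.df x w) = phi cov x v w := by
  rw [phi_apply, phi_apply, h.ricci_df hcov hcov']

theorem IsLocalIsomorphism.sharp_df (h : IsLocalIsomorphism J cov J' cov' f) (x : M)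
    (α : TangentSpace (𝓡 (2 * n)) (f x) →L[ℝ] ℝ) (β : TangentSpace (𝓡 (2 * n)) x →L[ℝ] ℝ)
    (hβ : ∀ v, β v = α (h.df x v)) : J'.sharp (f x) α = h.df x (J.sharp x β) := by
  rw [← sub_eq_zero]
  refine J'.nondegenerate _ _ fun w ↦ ?_
  obtain ⟨v, rfl⟩ := (h.df x).surjective w
  rw [map_sub, sub_apply, h.form_df, J.form_sharp, J'.form_sharp, hβ, sub_self]

theorem IsLocalIsomorphism.covDerivForm_df (h : IsLocalIsomorphism J cov J' cov' f)
    (hcov : IsSymplecticConnection J cov) (hcov' : IsSymplecticConnection J' cov') (x : M)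
    (u v w : TangentSpace (𝓡 (2 * n)) x) :
    covDerivForm cov' (phi cov') (f x) (h.df x u) (h.df x v) (h.df x w) =
      covDerivForm cov (phi cov) x u v w := by
  obtain ⟨X, X', hX, rfl⟩ := h.exists_related x u
  obtain ⟨Y, Y', hY, rfl⟩ := h.exists_related x v
  obtain ⟨Z, Z', hZ, rfl⟩ := h.exists_related x w
  have hΦ' := isSmoothForm_phi hcov'.smooth
  rw [← hX.2.2, ← hY.2.2, covDerivForm_apply hΦ' cov' hX.2.1 hY.2.1,
    covDerivForm_apply (isSmoothForm_phi hcov.smooth) cov hX.1 hY.1,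
    ← h.mvfderiv_comp (hΦ' _ hX.2.1 _ hY.2.1), ← hZ.2.2, h.cov_df hZ hX, h.cov_df hZ hY]
  simp only [hX.2.2, hY.2.2, h.phi_df hcov hcov']

theorem dualVector_eq (J : SymplecticForm n M) (x : M) (j : Fin (2 * n)) :
    dualVector J x j = sharpLin J x ((coordBasis x).coord j) := rfl

theorem IsLocalIsomorphism.sForm_df (h : IsLocalIsomorphism J cov J' cov' f)
    (hcov : IsSymplecticConnection J cov) (hcov' : IsSymplecticConnection J' cov') (x : M)
    (v : TangentSpace (𝓡 (2 * n)) x) :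
    sForm J' cov' (f x) (h.df x v) = sForm J cov x v := by
  rw [sForm_apply, sForm_apply]
  refine congrArg _ ?_
  have e (u : TangentSpace (𝓡 (2 * n)) x) (α : TangentSpace (𝓡 (2 * n)) (f x) →ₗ[ℝ] ℝ) :
      covDerivForm cov (phi cov) x v (sharpLin J x (α ∘ₗ (h.df x).toLinearEquiv.toLinearMap)) u =
        covDerivForm cov' (phi cov') (f x) (h.df x v) (sharpLin J' (f x) α) (h.df x u) := by
    rw [← h.covDerivForm_df hcov hcov']
    congr 2
    exact (h.sharp_df x _ _ fun v ↦ rfl).symm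
  have key := sum_apply_coord_eq (A := ℝ) (coordBasis x) (coordBasis (f x)) (h.df x).toLinearEquiv
    ((covDerivForm cov (phi cov) x v).comp (sharpLin J x)).flip
    (fun u α ↦ covDerivForm cov' (phi cov') (f x) (h.df x v) (sharpLin J' (f x) α) u)
    (fun u α ↦ by
      rw [LinearMap.flip_apply, LinearMap.comp_apply]
      exact e u α)
  simp only [LinearMap.flip_apply, LinearMap.comp_apply] at key
  simp only [dualVector_eq]
  exact key.symm

theorem IsLocalIsomorphism.covDerivCovector_df (h : IsLocalIsomorphism J cov J' cov' f)
    {μ' : Π x : M', TangentSpace (𝓡 (2 * n)) x →L[ℝ] ℝ} (hμ' : IsSmoothCovector μ') (x : M)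
    (u v : TangentSpace (𝓡 (2 * n)) x) :
    covDerivCovector cov' μ' (f x) (h.df x u) (h.df x v) =
      covDerivCovector cov
        (fun y ↦ (μ' (f y)).comp (mfderiv (𝓡 (2 * n)) (𝓡 (2 * n)) f y)) x u v := by
  -- a field on `M` need not descend to `M'`, so that smoothness is checked along `f`
  have hμ : IsSmoothCovector
      (fun y ↦ (μ' (f y)).comp (mfderiv (𝓡 (2 * n)) (𝓡 (2 * n)) f y)) := fun Y hY ↦ by
    have h1 := (contMDiff_covector_iff.2 hμ').comp h.contMDiff
    have h2 := (h.contMDiff.contMDiff_tangentMap (m := ∞) (by simp)).comp hY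
    have h3 := ContMDiff.clm_bundle_apply (F₁ := Model n) (F₂ := ℝ)
      (E₁ := (TangentSpace (𝓡 (2 * n)) : M' → Type))
      (E₂ := Bundle.Trivial M' ℝ) (b := f) h1 h2
    intro y
    simpa using! (contMDiffAt_totalSpace.1 (h3 y)).2
  obtain ⟨X, X', hX, rfl⟩ := h.exists_related x u
  obtain ⟨Y, Y', hY, rfl⟩ := h.exists_related x v
  rw [← hY.2.2, covDerivCovector_apply hμ' cov' hY.2.1, covDerivCovector_apply hμ cov hY.1,
    ← h.mvfderiv_comp (hμ' _ hY.2.1), ← hX.2.2, h.cov_df hX hY, h.df_apply]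
  simp only [hY.2.2, h.df_apply]
  rfl

/-- The tractor connection is natural. -/
theorem IsLocalIsomorphism.tractorDerivative_pullback (h : IsLocalIsomorphism J cov J' cov' f)
    (hcov : IsSymplecticConnection J cov) (hcov' : IsSymplecticConnection J' cov')
    {s : Π x : M', Tractor n M' x} (hs : IsSmoothSection n (TractorModel n) s) (x : M)
    (u : TangentSpace (𝓡 (2 * n)) x) :
    tractorDerivative J cov (fun y ↦ tractorPullback f y (s (f y))) x u
      = tractorPullback f x (tractorDerivative J' cov' s (f x)
          (mfderiv (𝓡 (2 * n)) (𝓡 (2 * n)) f x u)) := by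
  obtain ⟨h1, h2, h3⟩ := isSmoothSection_tractor_iff.1 hs
  rw [← h.df_apply, tractorDerivative_apply, tractorDerivative_apply]
  refine Prod.ext ?_ (Prod.ext ?_ ?_)
  · change mvfderiv (𝓡 (2 * n)) (fun y ↦ (s (f y)).1) x u - (s (f x)).2.1 (mfderiv _ _ f x u) =
      mvfderiv (𝓡 (2 * n)) (fun y ↦ (s y).1) (f x) (h.df x u) - (s (f x)).2.1 (h.df x u)
    rw [h.mvfderiv_comp h1, h.df_apply]
  · refine ContinuousLinearMap.ext fun v ↦ ?_
    change covDerivCovector cov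
        (fun y ↦ ((s (f y)).2.1).comp (mfderiv (𝓡 (2 * n)) (𝓡 (2 * n)) f y)) x u v
        + (s (f x)).2.2 * J.form x u v + (s (f x)).1 * phi cov x u v =
      covDerivCovector cov' (fun y ↦ (s y).2.1) (f x) (h.df x u) (mfderiv _ _ f x v)
        + (s (f x)).2.2 * J'.form (f x) (h.df x u) (mfderiv _ _ f x v)
        + (s (f x)).1 * phi cov' (f x) (h.df x u) (mfderiv _ _ f x v)
    rw [← h.df_apply, h.covDerivCovector_df h2, h.form_df, h.phi_df hcov hcov']
  · change mvfderiv (𝓡 (2 * n)) (fun y ↦ (s (f y)).2.2) x u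
        - phi cov x u (J.sharp x (((s (f x)).2.1).comp (mfderiv (𝓡 (2 * n)) (𝓡 (2 * n)) f x)))
        + (s (f x)).1 * sForm J cov x u =
      mvfderiv (𝓡 (2 * n)) (fun y ↦ (s y).2.2) (f x) (h.df x u)
        - phi cov' (f x) (h.df x u) (J'.sharp (f x) (s (f x)).2.1)
        + (s (f x)).1 * sForm J' cov' (f x) (h.df x u)
    rw [h.mvfderiv_comp h3, h.sForm_df hcov hcov',
      h.sharp_df x (s (f x)).2.1 (((s (f x)).2.1).comp (mfderiv (𝓡 (2 * n)) (𝓡 (2 * n)) f x))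
        (fun v ↦ by rw [h.df_apply]; rfl), h.phi_df hcov hcov']

end Naturality

/-! ### The curvature of the tractor connection -/

section TractorCurvature

variable {n : ℕ} {M : Type u} [TopologicalSpace M] [ChartedSpace (Model n) M]
  [IsManifold (𝓡 (2 * n)) ∞ M] [T2Space M] {J : SymplecticForm n M} {cov : AffineConnection n M}

theorem coe_two (x : M) : (2 : C^∞⟮𝓡 (2 * n), M; ℝ⟯) x = 2 := by
  have h : (2 : C^∞⟮𝓡 (2 * n), M; ℝ⟯) = 1 + 1 := one_add_one_eq_two.symm
  rw [h]
  exact one_add_one_eq_two (R := ℝ)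

/-- A smooth family of covectors as an operation on smooth vector fields. -/
def covectorHom {μ : Π x : M, TangentSpace (𝓡 (2 * n)) x →L[ℝ] ℝ} (hμ : IsSmoothCovector μ) :
    SmoothField n M →+ C^∞⟮𝓡 (2 * n), M; ℝ⟯ :=
  AddMonoidHom.mk' (fun Y ↦ ⟨fun y ↦ μ y (Y y), hμ Y Y.contMDiff⟩)
    fun Y Y' ↦ by ext y; exact map_add (μ y) (Y y) (Y' y)

/-- A smooth family of bilinear forms as an operation on smooth vector fields. -/
def formHom {Φ : Π x : M, TangentSpace (𝓡 (2 * n)) x →L[ℝ] TangentSpace (𝓡 (2 * n)) x →L[ℝ] ℝ}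
    (hΦ : IsSmoothForm Φ) : SmoothField n M →+ SmoothField n M →+ C^∞⟮𝓡 (2 * n), M; ℝ⟯ :=
  AddMonoidHom.mk' (fun Y ↦ covectorHom (hΦ Y Y.contMDiff))
    fun Y Y' ↦ by ext Z y; exact congr($(map_add (Φ y) (Y y) (Y' y)) (Z y))

/-- The vector field `J^♯ Φ(X, ·)`. -/
def sharpField (J : SymplecticForm n M)
    {Φ : Π x : M, TangentSpace (𝓡 (2 * n)) x →L[ℝ] TangentSpace (𝓡 (2 * n)) x →L[ℝ] ℝ}
    (hΦ : IsSmoothForm Φ) (X : SmoothField n M) : SmoothField n M :=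
  ⟨fun y ↦ J.sharp y (Φ y (X y)), isSmoothSection_sharp J (hΦ X X.contMDiff)⟩

theorem form_sharpField (hcov : IsSymplecticConnection J cov)
    {Φ : Π x : M, TangentSpace (𝓡 (2 * n)) x →L[ℝ] TangentSpace (𝓡 (2 * n)) x →L[ℝ] ℝ}
    (hΦ : IsSmoothForm Φ) (X Y : SmoothField n M) :
    (fieldCalculus hcov).J (sharpField J hΦ X) Y = formHom hΦ X Y := by
  ext y
  exact congr($(J.form_sharp y (Φ y (X y))) (Y y))

/-- The section `s` of the tractor bundle has the components `σ`, `μ`, `ρ`, the one-form being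
given by its values on smooth vector fields. -/
structure HasComponents (s : Π x : M, Tractor n M x) (σ : C^∞⟮𝓡 (2 * n), M; ℝ⟯)
    (μ : SmoothField n M → C^∞⟮𝓡 (2 * n), M; ℝ⟯) (ρ : C^∞⟮𝓡 (2 * n), M; ℝ⟯) : Prop where
  top (x : M) : (s x).1 = σ x
  mid (Z : SmoothField n M) (x : M) : (s x).2.1 (Z x) = μ Z x
  bot (x : M) : (s x).2.2 = ρ x

theorem exists_hasComponents {s : Π x : M, Tractor n M x}
    (hs : IsSmoothSection n (TractorModel n) s) :
    ∃ σ, ∃ μ : SmoothField n M →+ C^∞⟮𝓡 (2 * n), M; ℝ⟯, ∃ ρ, HasComponents s σ μ ρ := by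
  obtain ⟨h1, h2, h3⟩ := isSmoothSection_tractor_iff.1 hs
  exact ⟨⟨_, h1⟩, covectorHom h2, ⟨_, h3⟩, fun _ ↦ rfl, fun _ _ ↦ rfl, fun _ ↦ rfl⟩

theorem HasComponents.tractorDerivative {s : Π x : M, Tractor n M x} {σ ρ} {μ}
    (hs : HasComponents s σ μ ρ) (hcov : IsSymplecticConnection J cov) (X : SmoothField n M) :
    HasComponents (fun y ↦ tractorDerivative J cov s y (X y))
      ((fieldCalculus hcov).top X σ μ)
      ((fieldCalculus hcov).mid (formHom (isSmoothForm_phi hcov.smooth)) X σ μ ρ)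
      ((fieldCalculus hcov).bot (sharpField J (isSmoothForm_phi hcov.smooth))
        (covectorHom (isSmoothCovector_sForm J hcov.smooth)) X σ μ ρ) := by
  have e1 : (fun y ↦ (s y).1) = σ := funext hs.top
  have e3 : (fun y ↦ (s y).2.2) = ρ := funext hs.bot
  have e2 (Z : SmoothField n M) : (fun y ↦ (s y).2.1 (Z y)) = μ Z := funext (hs.mid Z)
  have h2 : IsSmoothCovector fun y ↦ (s y).2.1 := fun Z hZ ↦ by
    have := (μ ⟨Z, hZ⟩).contMDiff
    rw [← e2] at this
    exact this
  refine ⟨fun x ↦ ?_, fun Z x ↦ ?_, fun x ↦ ?_⟩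
  · change mvfderiv (𝓡 (2 * n)) (fun y ↦ (s y).1) x (X x) - (s x).2.1 (X x) =
      mvfderiv (𝓡 (2 * n)) σ x (X x) - μ X x
    rw [e1, hs.mid]
  · change covDerivCovector cov (fun y ↦ (s y).2.1) x (X x) (Z x) + (s x).2.2 * J.form x (X x) (Z x)
        + (s x).1 * phi cov x (X x) (Z x) =
      mvfderiv (𝓡 (2 * n)) (μ Z) x (X x) - μ ((fieldCalculus hcov).nab X Z) x
        + ρ x * J.form x (X x) (Z x) + σ x * phi cov x (X x) (Z x)
    rw [covDerivCovector_apply h2 cov Z.contMDiff, e2, hs.top, hs.bot, ← hs.mid]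
    rfl
  · change mvfderiv (𝓡 (2 * n)) (fun y ↦ (s y).2.2) x (X x)
        - phi cov x (X x) (J.sharp x (s x).2.1) + (s x).1 * sForm J cov x (X x) =
      mvfderiv (𝓡 (2 * n)) ρ x (X x) + μ (sharpField J (isSmoothForm_phi hcov.smooth) X) x
        + σ x * sForm J cov x (X x)
    have h : phi cov x (X x) (J.sharp x (s x).2.1) =
        - (s x).2.1 (J.sharp x (phi cov x (X x))) := by
      rw [← congr($(J.form_sharp x (phi cov x (X x))) (J.sharp x (s x).2.1)), J.skew,
        J.form_sharp]
    rw [e3, hs.top, h, ← hs.mid]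
    change _ - - (s x).2.1 (J.sharp x (phi cov x (X x))) + _ =
      _ + (s x).2.1 (J.sharp x (phi cov x (X x))) + _
    ring

variable {s : Π x : M, Tractor n M x} {σ ρ : C^∞⟮𝓡 (2 * n), M; ℝ⟯}
  {μ : SmoothField n M →+ C^∞⟮𝓡 (2 * n), M; ℝ⟯}

theorem curvature_tractor_eq (hcov : IsSymplecticConnection J cov)
    (X Y : SmoothField n M) (x : M) :
    curvature (tractorConnection J cov) X Y s x =
      tractorDerivative J cov (fun y ↦ tractorDerivative J cov s y (Y y)) x (X x)
      - tractorDerivative J cov (fun y ↦ tractorDerivative J cov s y (X y)) x (Y x)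
      - tractorDerivative J cov s x
        (((fieldCalculus hcov).nab X Y - (fieldCalculus hcov).nab Y X : SmoothField n M) x) := by
  unfold curvature
  rw [fieldNab_bracket hcov]
  rfl

theorem curvature_tractor_top (hcov : IsSymplecticConnection J cov) (hs : HasComponents s σ μ ρ)
    (X Y : SmoothField n M) (x : M) :
    (curvature (tractorConnection J cov) X Y s x).1 = 2 * J.form x (X x) (Y x) * (s x).2.2 := by
  have h := (fieldCalculus hcov).tractor_curv_top (Φ := formHom (isSmoothForm_phi hcov.smooth))
    σ μ ρ (fun X Y ↦ by ext y; exact phi_symm hcov y (X y) (Y y)) X Y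
  have h' := congr($h x)
  rw [curvature_tractor_eq hcov]
  have e1 := ((hs.tractorDerivative hcov Y).tractorDerivative hcov X).top x
  have e2 := ((hs.tractorDerivative hcov X).tractorDerivative hcov Y).top x
  have e3 := (hs.tractorDerivative hcov
    ((fieldCalculus hcov).nab X Y - (fieldCalculus hcov).nab Y X)).top x
  rw [hs.bot]
  refine Eq.trans congr($(congr($e1 - $e2)) - $e3) (h'.trans ?_)
  change (2 : C^∞⟮𝓡 (2 * n), M; ℝ⟯) x * J.form x (X x) (Y x) * ρ x = _
  rw [coe_two]

theorem curvature_tractor_mid (hcov : IsSymplecticConnection J cov) (hs : HasComponents s σ μ ρ)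
    (X Y Z : SmoothField n M) (x : M) :
    (curvature (tractorConnection J cov) X Y s x).2.1 (Z x) =
      - (s x).2.1 (curvatureTensor cov x (X x) (Y x) (Z x))
      + (covDerivForm cov (phi cov) x (Y x) (Z x) (X x)
        - covDerivForm cov (phi cov) x (X x) (Z x) (Y x)
        + J.form x (X x) (Z x) * sForm J cov x (Y x) - J.form x (Y x) (Z x) * sForm J cov x (X x))
        * (s x).1
      + J.form x (X x) (Z x) * (s x).2.1 (J.sharp x (phi cov x (Y x)))
      - J.form x (Y x) (Z x) * (s x).2.1 (J.sharp x (phi cov x (X x)))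
      - phi cov x (X x) (Z x) * (s x).2.1 (Y x) + phi cov x (Y x) (Z x) * (s x).2.1 (X x) := by
  have hΦ := isSmoothForm_phi hcov.smooth
  have h := (fieldCalculus hcov).tractor_curv_mid (Φ := formHom hΦ)
    (sh := sharpField J hΦ) (S := covectorHom (isSmoothCovector_sForm J hcov.smooth))
    σ μ ρ X Y Z
  have h' := congr($h x)
  rw [curvature_tractor_eq hcov]
  have e1 := ((hs.tractorDerivative hcov Y).tractorDerivative hcov X).mid Z x
  have e2 := ((hs.tractorDerivative hcov X).tractorDerivative hcov Y).mid Z x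
  have e3 := (hs.tractorDerivative hcov
    ((fieldCalculus hcov).nab X Y - (fieldCalculus hcov).nab Y X)).mid Z x
  refine Eq.trans (congr($(congr($e1 - $e2)) - $e3)) (h'.trans ?_)
  rw [covDerivForm_apply hΦ cov Y.contMDiff Z.contMDiff,
    covDerivForm_apply hΦ cov X.contMDiff Z.contMDiff, curvatureTensor_eq_curv hcov, hs.top,
    hs.mid, hs.mid, hs.mid]
  have e4 := hs.mid (sharpField J hΦ Y) x
  have e5 := hs.mid (sharpField J hΦ X) x
  change (s x).2.1 (J.sharp x (phi cov x (Y x))) = _ at e4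
  change (s x).2.1 (J.sharp x (phi cov x (X x))) = _ at e5
  rw [e4, e5]
  rfl

/-- The bilinear form `∇_a S_b - Φ_ac J^ce Φ_be`, whose skew part is the coefficient of `σ` in the
last component of the tractor curvature. -/
def derivSForm (J : SymplecticForm n M) (cov : AffineConnection n M) (x : M) :
    TangentSpace (𝓡 (2 * n)) x →ₗ[ℝ] TangentSpace (𝓡 (2 * n)) x →ₗ[ℝ] ℝ :=
  LinearMap.mk₂ ℝ (fun u v ↦ covDerivCovector cov (sForm J cov) x u v
      - phi cov x u (J.sharp x (phi cov x v)))
    (fun _ _ _ ↦ by simp; ring) (fun _ _ _ ↦ by simp; ring)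
    (fun _ _ _ ↦ by simp; ring) (fun _ _ _ ↦ by simp; ring)

theorem curvature_tractor_bot (hcov : IsSymplecticConnection J cov) (hs : HasComponents s σ μ ρ)
    (X Y : SmoothField n M) (x : M) :
    (curvature (tractorConnection J cov) X Y s x).2.2 =
      (s x).2.1 (((fieldCalculus hcov).nab X (sharpField J (isSmoothForm_phi hcov.smooth) Y)
        - (fieldCalculus hcov).nab Y (sharpField J (isSmoothForm_phi hcov.smooth) X)
        - sharpField J (isSmoothForm_phi hcov.smooth)
          ((fieldCalculus hcov).nab X Y - (fieldCalculus hcov).nab Y X) : SmoothField n M) x)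
      - sForm J cov x (X x) * (s x).2.1 (Y x) + sForm J cov x (Y x) * (s x).2.1 (X x)
      + (derivSForm J cov x (X x) (Y x) - derivSForm J cov x (Y x) (X x)) * (s x).1 := by
  have hΦ := isSmoothForm_phi hcov.smooth
  have hS := isSmoothCovector_sForm J hcov.smooth
  have h := (fieldCalculus hcov).tractor_curv_bot (Φ := formHom hΦ)
    (sh := sharpField J hΦ) (S := covectorHom hS)
    σ μ ρ (fun X Y ↦ by ext y; exact phi_symm hcov y (X y) (Y y)) (form_sharpField hcov hΦ) X Y
  have h' := congr($h x)
  rw [curvature_tractor_eq hcov]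
  have e1 := ((hs.tractorDerivative hcov Y).tractorDerivative hcov X).bot x
  have e2 := ((hs.tractorDerivative hcov X).tractorDerivative hcov Y).bot x
  have e3 := (hs.tractorDerivative hcov
    ((fieldCalculus hcov).nab X Y - (fieldCalculus hcov).nab Y X)).bot x
  refine Eq.trans (congr($(congr($e1 - $e2)) - $e3)) (h'.trans ?_)
  rw [hs.mid, hs.mid, hs.mid, hs.top]
  change _ = _ - _ + _ + ((covDerivCovector cov (sForm J cov) x (X x) (Y x)
      - phi cov x (X x) (J.sharp x (phi cov x (Y x))))
    - (covDerivCovector cov (sForm J cov) x (Y x) (X x)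
      - phi cov x (Y x) (J.sharp x (phi cov x (X x))))) * _
  rw [covDerivCovector_apply hS cov Y.contMDiff, covDerivCovector_apply hS cov X.contMDiff]
  rfl

end TractorCurvature

section VanishingV

variable {n : ℕ} {M : Type u} [TopologicalSpace M] [ChartedSpace (Model n) M]
  [IsManifold (𝓡 (2 * n)) ∞ M] [T2Space M] {J : SymplecticForm n M} {cov : AffineConnection n M}

theorem form_curv_eq_phiCurv (hcov : IsSymplecticConnection J cov)
    (hV : ∀ x u v w, vTensor J cov x u v w = 0) (X Y Z T : SmoothField n M) :
    (fieldCalculus hcov).J ((fieldCalculus hcov).curv X Y Z) T =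
      (fieldCalculus hcov).phiCurv (formHom (isSmoothForm_phi hcov.smooth) · ·) X Y Z T := by
  ext x
  change J.form x ((fieldCalculus hcov).curv X Y Z x) (T x) =
    phi cov x (Y x) (Z x) * J.form x (X x) (T x) - phi cov x (X x) (Z x) * J.form x (Y x) (T x)
    + J.form x (X x) (Z x) * phi cov x (Y x) (T x) - J.form x (Y x) (Z x) * phi cov x (X x) (T x)
    + (2 : C^∞⟮𝓡 (2 * n), M; ℝ⟯) x * J.form x (X x) (Y x) * phi cov x (Z x) (T x)
  rw [← curvatureTensor_eq_curv, sub_eq_zero.1 (hV x (X x) (Y x) (Z x)), coe_two]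
  simp [phiCurvature, J.form_sharp]

theorem dForm_apply (hcov : IsSymplecticConnection J cov) (X Y Z : SmoothField n M) (x : M) :
    (fieldCalculus hcov).DForm (formHom (isSmoothForm_phi hcov.smooth)) X Y Z x =
      covDerivForm cov (phi cov) x (Y x) (Z x) (X x) := by
  rw [covDerivForm_apply (isSmoothForm_phi hcov.smooth) cov Y.contMDiff Z.contMDiff]
  rfl

/-- If `V` vanishes, the second Bianchi identity determines the skew part of `∇Φ`. -/
theorem covDerivForm_skew_part (hcov : IsSymplecticConnection J cov)
    (hV : ∀ x u v w, vTensor J cov x u v w = 0) (x : M) (u v w : TangentSpace (𝓡 (2 * n)) x) :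
    covDerivForm cov (phi cov) x v w u - covDerivForm cov (phi cov) x u w v =
      - J.form x u w * sForm J cov x v + J.form x v w * sForm J cov x u
        - 2 * J.form x u v * sForm J cov x w := by
  refine skew_part_of_bianchi (formLin_dualVector J x) (J.skew x) (covDerivForm cov (phi cov) x)
    (fun u v w ↦ ?_) (fun u v w z t ↦ ?_) (sForm J cov x) (fun v ↦ ?_) u v w
  · obtain ⟨X, rfl⟩ := exists_smoothField x u
    obtain ⟨Y, rfl⟩ := exists_smoothField x v
    obtain ⟨Z, rfl⟩ := exists_smoothField x w
    have hΦ := isSmoothForm_phi hcov.smooth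
    rw [covDerivForm_apply hΦ cov X.contMDiff Y.contMDiff,
      covDerivForm_apply hΦ cov Y.contMDiff X.contMDiff, phi_symm hcov x (cov X x (Z x)),
      phi_symm hcov x (X x)]
    simp only [phi_symm hcov _ (X _) (Y _)]
    ring
  · obtain ⟨X, rfl⟩ := exists_smoothField x u
    obtain ⟨Y, rfl⟩ := exists_smoothField x v
    obtain ⟨Z, rfl⟩ := exists_smoothField x w
    obtain ⟨W, rfl⟩ := exists_smoothField x z
    obtain ⟨T, rfl⟩ := exists_smoothField x t
    have h := congr($((fieldCalculus hcov).second_bianchi_phiCurv (form_curv_eq_phiCurv hcov hV)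
      X Y Z W T) x)
    simp only [← dForm_apply hcov]
    rw [← coe_two (n := n) x]
    exact h
  · rw [sForm_apply, Fintype.card_fin]
    push_cast
    field_simp

/-- If `V` vanishes, the Ricci identity for `Φ` shows that the skew part of
`∇_a S_b - Φ_ac J^ce Φ_be` is a multiple of `J_ab`. -/
theorem derivSForm_skew_part (hcov : IsSymplecticConnection J cov)
    (hV : ∀ x u v w, vTensor J cov x u v w = 0) (x : M) (u v : TangentSpace (𝓡 (2 * n)) x) :
    derivSForm J cov x u v - derivSForm J cov x v u = 2 * J.form x u v *
      ((∑ j, derivSForm J cov x (dualVector J x j) (coordBasis x j)) / (2 * n : ℕ)) := by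
  have h := skew_part_eq_form (formLin_dualVector J x) (J.skew x) (derivSForm J cov x)
    (fun e u v w ↦ ?_) u v
  · rw [Fintype.card_fin] at h
    exact h
  obtain ⟨E, rfl⟩ := exists_smoothField x e
  obtain ⟨X, rfl⟩ := exists_smoothField x u
  obtain ⟨Y, rfl⟩ := exists_smoothField x v
  obtain ⟨Z, rfl⟩ := exists_smoothField x w
  have hΦ := isSmoothForm_phi hcov.smooth
  have hS := isSmoothCovector_sForm J hcov.smooth
  have key := congr($((fieldCalculus hcov).cyclic_form_skew_part (S := covectorHom hS)
    (form_curv_eq_phiCurv hcov hV)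
    (fun X Y ↦ by ext y; exact phi_symm hcov y (X y) (Y y)) (form_sharpField hcov hΦ)
    (fun X Y Z ↦ by
      ext y
      have := covDerivForm_skew_part hcov hV y (X y) (Y y) (Z y)
      rw [← dForm_apply hcov, ← dForm_apply hcov, ← coe_two (n := n) y] at this
      exact this) _ (fun _ _ ↦ rfl) E X Y Z) x)
  have hN (X Y : SmoothField n M) : ((fieldCalculus hcov).DCov (covectorHom hS) X Y -
      formHom hΦ X (sharpField J hΦ Y)) x = derivSForm J cov x (X x) (Y x) := by
    change _ = covDerivCovector cov (sForm J cov) x (X x) (Y x) - _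
    rw [covDerivCovector_apply hS cov Y.contMDiff]
    rfl
  simp only [← hN]
  rw [← coe_two (n := n) x]
  exact key

/-- If `V` vanishes, the skew part of the derivative of `J^♯ Φ` is built from `S`. It is the
coefficient of `μ` in the last component of the tractor curvature. -/
theorem nab_sharpField (hcov : IsSymplecticConnection J cov)
    (hV : ∀ x u v w, vTensor J cov x u v w = 0) (X Y : SmoothField n M) (x : M) :
    ((fieldCalculus hcov).nab X (sharpField J (isSmoothForm_phi hcov.smooth) Y)
        - (fieldCalculus hcov).nab Y (sharpField J (isSmoothForm_phi hcov.smooth) X)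
        - sharpField J (isSmoothForm_phi hcov.smooth)
          ((fieldCalculus hcov).nab X Y - (fieldCalculus hcov).nab Y X) : SmoothField n M) x =
      - sForm J cov x (Y x) • X x + sForm J cov x (X x) • Y x
        - (2 * J.form x (X x) (Y x)) • J.sharp x (sForm J cov x) := by
  rw [← sub_eq_zero]
  refine J.nondegenerate x _ fun w ↦ ?_
  obtain ⟨Z, rfl⟩ := exists_smoothField x w
  have hΦ := isSmoothForm_phi hcov.smooth
  set C := fieldCalculus hcov with hC
  have h1 : C.J (C.nab X (sharpField J hΦ Y) - C.nab Y (sharpField J hΦ X)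
        - sharpField J hΦ (C.nab X Y - C.nab Y X)) Z =
      C.DForm (formHom hΦ) X Y Z - C.DForm (formHom hΦ) Y X Z := by
    have p1 := C.parallel X (sharpField J hΦ Y) Z
    have p2 := C.parallel Y (sharpField J hΦ X) Z
    simp only [hC, form_sharpField] at p1 p2
    simp only [hC, map_sub, AddMonoidHom.sub_apply, form_sharpField, SymplecticCalculus.DForm]
    linear_combination p2 - p1
  have h2 := congr($h1 x)
  have h3 := covDerivForm_skew_part hcov hV x (X x) (Y x) (Z x)
  rw [← dForm_apply hcov, ← dForm_apply hcov] at h3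
  have h4 : J.form x ((C.nab X (sharpField J hΦ Y) - C.nab Y (sharpField J hΦ X)
        - sharpField J hΦ (C.nab X Y - C.nab Y X) : SmoothField n M) x) (Z x) = _ := h2.trans h3
  rw [map_sub, sub_apply, h4]
  simp [J.form_sharp]
  ring

end VanishingV

/-! ### Symplectic flatness -/

section Flatness

variable {n : ℕ} {M : Type u} [TopologicalSpace M] [ChartedSpace (Model n) M]
  [IsManifold (𝓡 (2 * n)) ∞ M] {J : SymplecticForm n M} {cov : AffineConnection n M}

instance (x : M) : FiniteDimensional ℝ (Tractor n M x) :=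
  inferInstanceAs (FiniteDimensional ℝ (ℝ × (Model n →L[ℝ] ℝ) × ℝ))

/-- The endomorphism `(σ, μ_b, ρ) ↦ (ρ, -J^ce Φ_be μ_c - S_b σ, -J^ce S_e μ_c + θ σ)` of the tractor
bundle, where `θ = (1 / 2n) J^ab (∇_a S_b - Φ_ac J^ce Φ_be)`. For `n = 0` the quotient is the junk
value `0`, which is harmless since the tangent spaces vanish. -/
def flatEndomorphism (J : SymplecticForm n M) (cov : AffineConnection n M) (x : M) :
    Tractor n M x →L[ℝ] Tractor n M x :=
  LinearMap.toContinuousLinearMap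
    { toFun := fun t ↦ (t.2.2,
        (- (t.2.1 : TangentSpace (𝓡 (2 * n)) x →L[ℝ] ℝ).comp ((J.sharp x).comp (phi cov x))
          - t.1 • sForm J cov x : TangentSpace (𝓡 (2 * n)) x →L[ℝ] ℝ),
        - (t.2.1 : TangentSpace (𝓡 (2 * n)) x →L[ℝ] ℝ) (J.sharp x (sForm J cov x))
          + ((∑ j, derivSForm J cov x (dualVector J x j) (coordBasis x j)) / (2 * n : ℕ)) * t.1)
      map_add' := fun s t ↦ by
        refine Prod.ext rfl (Prod.ext (ContinuousLinearMap.ext fun v ↦ ?_) ?_)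
        · change -((s.2.1 : TangentSpace (𝓡 (2 * n)) x →L[ℝ] ℝ) _ + t.2.1 _)
            - (s.1 + t.1) * sForm J cov x v =
            (-(s.2.1 _) - s.1 * sForm J cov x v) + (-(t.2.1 _) - t.1 * sForm J cov x v)
          ring
        · change -(s.2.1 _ + t.2.1 _) + _ * (s.1 + t.1) =
            (- s.2.1 _ + _ * s.1) + (- t.2.1 _ + _ * t.1)
          ring
      map_smul' := fun c t ↦ by
        refine Prod.ext rfl (Prod.ext (ContinuousLinearMap.ext fun v ↦ ?_) ?_)
        · change -(c * t.2.1 _) - (c * t.1) * sForm J cov x v =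
            c * (-(t.2.1 _) - t.1 * sForm J cov x v)
          ring
        · change -(c * t.2.1 _) + _ * (c * t.1) = c * (- t.2.1 _ + _ * t.1)
          ring }

theorem flatEndomorphism_mid (x : M) (t : Tractor n M x) (v : TangentSpace (𝓡 (2 * n)) x) :
    (flatEndomorphism J cov x t).2.1 v =
      - t.2.1 (J.sharp x (phi cov x v)) - t.1 * sForm J cov x v := rfl

theorem flatEndomorphism_bot (x : M) (t : Tractor n M x) :
    (flatEndomorphism J cov x t).2.2 = - t.2.1 (J.sharp x (sForm J cov x))
      + ((∑ j, derivSForm J cov x (dualVector J x j) (coordBasis x j)) / (2 * n : ℕ)) * t.1 := rfl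

variable [T2Space M]

theorem isSmoothSection_flatEndomorphism (J : SymplecticForm n M)
    (hcov : CovariantDerivative.ContMDiffCovariantDerivative cov ∞) {s : Π x : M, Tractor n M x}
    (hs : IsSmoothSection n (TractorModel n) s) :
    IsSmoothSection n (TractorModel n) fun x ↦ flatEndomorphism J cov x (s x) := by
  obtain ⟨h1, h2, h3⟩ := isSmoothSection_tractor_iff.1 hs
  have hΦ := isSmoothForm_phi hcov
  have hS := isSmoothCovector_sForm J hcov
  refine isSmoothSection_tractor_iff.2 ⟨h3, fun Y hY ↦ ?_, ?_⟩
  · exact (h2 _ (isSmoothSection_sharp J (hΦ Y hY))).neg.sub (h1.mul (hS Y hY))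
  · refine (h2 _ (isSmoothSection_sharp J hS)).neg.add (ContMDiff.mul ?_ h1)
    simp only [div_eq_inv_mul]
    have h := contMDiff_sum_dualVector J (derivSForm J cov) fun Y Z hY hZ ↦
      (isSmoothForm_covDerivCovector hS hcov Y hY Z hZ).sub
        (hΦ Y hY _ (isSmoothSection_sharp J (hΦ Z hZ)))
    have h' : ContMDiff (𝓡 (2 * n)) 𝓘(ℝ, ℝ) ∞ fun x ↦ (((2 * n : ℕ) : ℝ))⁻¹ *
        ∑ j, derivSForm J cov x (dualVector J x j) (coordBasis x j) := contMDiff_const.mul h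
    exact h'

/-- If `V` vanishes, the tractor connection is symplectically flat. -/
theorem isSymplecticallyFlat_of_vTensor_eq_zero (hcov : IsSymplecticConnection J cov)
    (hV : ∀ x u v w, vTensor J cov x u v w = 0) :
    IsSymplecticallyFlat J (tractorConnection J cov) := by
  refine ⟨flatEndomorphism J cov, fun s hs ↦ isSmoothSection_flatEndomorphism J hcov.smooth hs,
    fun X Y s hX hY hs x ↦ ?_⟩
  obtain ⟨σ, μ, ρ, hc⟩ := exists_hasComponents hs
  obtain ⟨X, rfl⟩ : ∃ X' : SmoothField n M, ⇑X' = X := ⟨⟨X, hX⟩, rfl⟩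
  obtain ⟨Y, rfl⟩ : ∃ Y' : SmoothField n M, ⇑Y' = Y := ⟨⟨Y, hY⟩, rfl⟩
  refine Prod.ext ?_ (Prod.ext (ContinuousLinearMap.ext fun w ↦ ?_) ?_)
  · exact curvature_tractor_top hcov hc X Y x
  · obtain ⟨Z, rfl⟩ := exists_smoothField x w
    change _ = 2 * J.form x (X x) (Y x) * (flatEndomorphism J cov x (s x)).2.1 (Z x)
    rw [flatEndomorphism_mid]
    refine (curvature_tractor_mid hcov hc X Y Z x).trans ?_
    rw [covDerivForm_skew_part hcov hV, sub_eq_zero.1 (hV x (X x) (Y x) (Z x)), phiCurvature]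
    simp only [map_add, map_sub, map_smul, smul_eq_mul]
    ring
  · change _ = 2 * J.form x (X x) (Y x) * (flatEndomorphism J cov x (s x)).2.2
    rw [flatEndomorphism_bot]
    refine (curvature_tractor_bot hcov hc X Y x).trans ?_
    rw [nab_sharpField hcov hV, derivSForm_skew_part hcov hV]
    simp only [map_add, map_sub, map_smul, smul_eq_mul]
    ring

/-- If the tractor connection is symplectically flat, the one-form component of its curvature shows
that `V_ab^c_d = J_ab Z^c_d`, and `V` vanishes since it is trace-free. -/
theorem vTensor_eq_zero_of_isSymplecticallyFlat (hcov : IsSymplecticConnection J cov)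
    (hflat : IsSymplecticallyFlat J (tractorConnection J cov)) (x : M)
    (u v w : TangentSpace (𝓡 (2 * n)) x) : vTensor J cov x u v w = 0 := by
  obtain ⟨Θ, -, hΘ⟩ := hflat
  have key (α : TangentSpace (𝓡 (2 * n)) x →L[ℝ] ℝ) : ∃ z : ℝ, ∀ u v,
      α (vTensor J cov x u v w) = J.form x u v * z := by
    obtain ⟨s, hs, hsx⟩ := exists_smooth_section (I := 𝓡 (2 * n)) (F := TractorModel n)
      (V := Tractor n M) x ((0, α, 0) : Tractor n M x)
    obtain ⟨σ, μ, ρ, hc⟩ := exists_hasComponents hs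
    have hs1 : (s x).1 = 0 := by rw [hsx]
    have hs2 : (s x).2.1 = α := by rw [hsx]
    refine ⟨- 2 * (Θ x (s x)).2.1 w - 2 * α (J.sharp x (phi cov x w)), fun u v ↦ ?_⟩
    obtain ⟨X, rfl⟩ := exists_smoothField x u
    obtain ⟨Y, rfl⟩ := exists_smoothField x v
    obtain ⟨Z, rfl⟩ := exists_smoothField x w
    have h := curvature_tractor_mid hcov hc X Y Z x
    rw [hΘ X Y s X.contMDiff Y.contMDiff hs, hs1, hs2] at h
    change 2 * J.form x (X x) (Y x) * (Θ x (s x)).2.1 (Z x) = _ at h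
    simp only [vTensor, phiCurvature, map_add, map_sub, map_smul, smul_eq_mul]
    linear_combination h
  choose z hz using key
  -- the trace of `J_ab Z^c_d` over `a` and `c` is the contraction of `J` with `Z`
  have hζ : ∑ i, z (LinearMap.toContinuousLinearMap ((coordBasis x).coord i)) •
      coordBasis x i = 0 := by
    refine J.nondegenerate x _ fun v ↦ ?_
    rw [← trace_vTensor hcov x v w, map_sum, sum_apply]
    refine Finset.sum_congr rfl fun i _ ↦ ?_
    rw [map_smul, smul_apply, smul_eq_mul, mul_comm]
    exact (hz _ _ _).symm
  have h0 := Fintype.linearIndependent_iff.1 (coordBasis x).linearIndependent _ hζ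
  refine (coordBasis x).ext_elem fun i ↦ ?_
  have := hz (LinearMap.toContinuousLinearMap ((coordBasis x).coord i)) u v
  rw [h0, mul_zero] at this
  simpa using this

theorem hasPhiCurvature_iff (hcov : IsSymplecticConnection J cov) :
    HasPhiCurvature J cov ↔ ∀ x u v w, vTensor J cov x u v w = 0 := by
  constructor
  · rintro ⟨Φ, -, hsymm, hΦ⟩ x u v w
    have h (v w) : phi cov x v w = Φ x v w := by
      have := trace_phiCurvature (J := J) x (hsymm x) v w
      rw [phi_apply, ricci_apply]
      simp only [hΦ, this]
      field_simp
    have h' : phi cov x = Φ x := by ext v w; exact h v w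
    rw [vTensor, hΦ, phiCurvature, phiCurvature, h', sub_self]
  · intro hV
    exact ⟨phi cov, contMDiff_form_iff.2 (isSmoothForm_phi hcov.smooth), phi_symm hcov,
      fun x u v w ↦ sub_eq_zero.1 (hV x u v w)⟩

theorem isSymplecticallyFlat_iff (hcov : IsSymplecticConnection J cov) :
    IsSymplecticallyFlat J (tractorConnection J cov) ↔ ∀ x u v w, vTensor J cov x u v w = 0 :=
  ⟨vTensor_eq_zero_of_isSymplecticallyFlat hcov, isSymplecticallyFlat_of_vTensor_eq_zero hcov⟩

end Flatness

end

end SymplecticTractor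

theorem theorem2 {n : ℕ} {M : Type u} [TopologicalSpace M] [T2Space M]
    [SecondCountableTopology M] [ChartedSpace (Model n) M]
    [IsManifold (𝓡 (2 * n)) ∞ M]
    (J : SymplecticForm n M) (cov : AffineConnection n M)
    (hcov : IsSymplecticConnection J cov) :
    -- the curvature tensor and its decomposition
    (∀ X Y Z : Π x : M, TangentSpace (𝓡 (2 * n)) x,
      IsSmoothSection n (Model n) X →
      IsSmoothSection n (Model n) Y →
      IsSmoothSection n (Model n) Z →
      ∀ x, curvatureTensor cov x (X x) (Y x) (Z x)
        = curvature cov X Y Z x) ∧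
    (∀ x (v w : TangentSpace (𝓡 (2 * n)) x),
      phi cov x v w = phi cov x w v) ∧
    (∀ x (v w : TangentSpace (𝓡 (2 * n)) x),
      ∑ i, (coordBasis x).coord i
        (vTensor J cov x (coordBasis x i) v w) = 0) ∧
    -- the tractor bundle is a smooth vector bundle of rank `2n + 2`
    ContMDiffVectorBundle ∞ (TractorModel n) (Tractor n M)
      (𝓡 (2 * n)) ∧
    (∀ x : M, Module.finrank ℝ (Tractor n M x) = 2 * n + 2) ∧
    -- the tractor connection is a smooth connection on it
    ∃ D : CovariantDerivative (𝓡 (2 * n)) (TractorModel n)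
        (Tractor n M),
      D.toFun = tractorDerivative J cov ∧
      CovariantDerivative.ContMDiffCovariantDerivative D ∞ ∧
      -- the construction is natural
      (∀ (M' : Type u) [TopologicalSpace M'] [T2Space M'] [SecondCountableTopology M']
        [ChartedSpace (Model n) M'] [IsManifold (𝓡 (2 * n)) ∞ M']
        (J' : SymplecticForm n M')
        (cov' : AffineConnection n M') (f : M → M'),
        IsSymplecticConnection J' cov' →
        IsLocalIsomorphism J cov J' cov' f →
        ∀ s : Π x : M', Tractor n M' x,
          IsSmoothSection n (TractorModel n) s →
          ∀ (x : M) (u : TangentSpace (𝓡 (2 * n)) x),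
            D (fun y ↦ tractorPullback f y (s (f y))) x u
              = tractorPullback f x
                  (tractorDerivative J' cov' s (f x)
                    (mfderiv (𝓡 (2 * n)) (𝓡 (2 * n)) f x u))) ∧
      -- symplectic flatness
      (IsSymplecticallyFlat J D ↔ HasPhiCurvature J cov) ∧
      (IsSymplecticallyFlat J D ↔
        ∀ x u v w, vTensor J cov x u v w = 0) := by
  have hs := hcov.smooth
  refine ⟨fun X Y Z hX hY hZ ↦ curvatureTensor_apply hs hX hY hZ, phi_symm hcov,
    trace_vTensor hcov, inferInstance, finrank_tractor, tractorConnection J cov, rfl,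
    contMDiff_tractorConnection J hs, ?_, ?_, isSymplecticallyFlat_iff hcov⟩
  · intro M' _ _ _ _ _ J' cov' f hcov' hf s hs' x u
    exact hf.tractorDerivative_pullback hcov hcov' hs' x u
  · exact (isSymplecticallyFlat_iff hcov).trans (hasPhiCurvature_iff hcov).symm
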